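/- Let $\mathcal A$ be a unital $C^*$-algebra with center $Z(\mathcal A)$, and let $H_{\mathcal A}$ be the standard Hilbert $\mathcal A$-module: the sequences $x=(x_i)_{i\in\mathbb N}$ in $\mathcal A$ for which $\sum_i x_ix_i^*$ converges in norm, with $\langle x,y\rangle=\sum_i y_ix_i^*$ and $\|x\|=\|\langle x,x\rangle\|^{1/2}$ (Hilbert modules are written as left modules; replacing $\mathcal A$ by the opposite algebra gives the same statement for right modules). Let $B^a(H_{\mathcal A})$ be the set of bounded adjointable $\mathcal A$-linear operators on $H_{\mathcal A}$, and for $\alpha\in Z(\mathcal A)$ let $\alpha I$ be multiplication by $\alpha$ on $H_{\mathcal A}$. "Finitely generated" means finitely generated as an $\mathcal A$-module, and $\cong$ means isomorphic by a bounded $\mathcal A$-linear map with bounded inverse. $K(\mathcal A)$ denotes the Grothendieck group of the monoid of isomorphism classes $[N]$ of finitely generated Hilbert $\mathcal A$-modules under direct sum. It has the cancellation property if $[M]=[N]$ in $K(\mathcal A)$ implies $M\cong N$ for all finitely generated closed submodules $M,N\subseteq H_{\mathcal A}$. A decomposition for $F\in B^a(H_{\mathcal A})$ consists of closed submodules with $H_{\mathcal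 A}=M_1\tilde\oplus N_1=M_2\tilde\oplus N_2$ (direct sums, not necessarily orthogonal) such that $F$ maps $M_1$ isomorphically onto $M_2$ and $F(N_1)\subseteq N_2$. Write $M\preceq N$ if $M$ is isomorphic to a closed submodule of $N$. Define the following subsets of $B^a(H_{\mathcal A})$: - $\mathcal M\Phi_+$ (respectively $\mathcal M\Phi_-$, $\mathcal M\Phi$): there is a decomposition for $F$ with $N_1$ (respectively $N_2$, both $N_1$ and $N_2$) finitely generated; - $\mathcal M\Phi_0$: those $F\in\mathcal M\Phi$ with $\operatorname{index}F=0$, where $\operatorname{index}F=[N_1]-[N_2]\in K(\mathcal A)$ for any decomposition with $N_1,N_2$ finitely generated; - $\widetilde{\mathcal M\Phi}{}_+^-$ (respectively $\widetilde{\mathcal M\Phi}{}_-^+$): there is a decomposition for $F$ with $N_1,N_2$ finitely generated and $N_1\preceq N_2$ (respectively $N_2\preceq N_1$); - $\mathcal M\Phi_+^-=\widetilde{\mathcal M\Phi}{}_+^-\cup(\mathcal M\Phi_+\setminus\mathcal M\Phi)$ and $\mathcal M\Phi_-^+=\widetilde{\mathcal M\Phi}{}_-^+\cup(\mathcal M\Phi_-\setminus\mathcal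 M\Phi)$. For $F\in B^a(H_{\mathcal A})$ let $\sigma^{\mathcal A}_{ew}(F)$, $\sigma^{\mathcal A}_{e\alpha}(F)$, $\sigma^{\mathcal A}_{e\beta}(F)$, $\sigma^{\mathcal A}_{e\tilde a}(F)$, $\sigma^{\mathcal A}_{ea}(F)$, $\sigma^{\mathcal A}_{e\tilde b}(F)$, $\sigma^{\mathcal A}_{eb}(F)$ be the set of all $\alpha\in Z(\mathcal A)$ such that $F-\alpha I$ does not belong to $\mathcal M\Phi_0$, $\mathcal M\Phi_+$, $\mathcal M\Phi_-$, $\widetilde{\mathcal M\Phi}{}_+^-$, $\mathcal M\Phi_+^-$, $\widetilde{\mathcal M\Phi}{}_-^+$, $\mathcal M\Phi_-^+$, respectively, and let $\partial$ denote the boundary in $Z(\mathcal A)$ with its norm topology. **Theorem.** For every $F\in B^a(H_{\mathcal A})$, $$\partial\sigma^{\mathcal A}_{ew}(F)\subseteq\partial\sigma^{\mathcal A}_{e\tilde a}(F)\subseteq\partial\sigma^{\mathcal A}_{ea}(F),\qquad \partial\sigma^{\mathcal A}_{ew}(F)\subseteq\partial\sigma^{\mathcal A}_{e\tilde b}(F)\subseteq\partial\sigma^{\mathcal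 A}_{eb}(F).$$ If moreover $K(\mathcal A)$ has the cancellation property, then $$\partial\sigma^{\mathcal A}_{ea}(F)\subseteq\partial\sigma^{\mathcal A}_{e\alpha}(F)\qquad\text{and}\qquad \partial\sigma^{\mathcal A}_{eb}(F)\subseteq\partial\sigma^{\mathcal A}_{e\beta}(F).$$ -/

import Mathlib

open scoped Topology

universe u

namespace HilbertFredholm

/-! ### The standard Hilbert module -/

section Sums

theorem summable_smul_mul_star {A : Type u} [CStarAlgebra A] {ι : Type*} (a : A)
    {x : ι → A} (hx : Summable fun i => x i * star (x i)) :
    Summable fun i => (a * x i) * star (a * x i) := by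
  have := (hx.mul_left a).mul_right (star a)
  refine this.congr fun i => ?_
  simp [mul_assoc]

theorem summable_csmul_mul_star {A : Type u} [CStarAlgebra A] {ι : Type*} (c : ℂ)
    {x : ι → A} (hx : Summable fun i => x i * star (x i)) :
    Summable fun i => (c • x i) * star (c • x i) := by
  have := summable_smul_mul_star (c • (1 : A)) hx
  simpa using this

variable {A : Type u} [CStarAlgebra A] [PartialOrder A] [StarOrderedRing A] {ι : Type*}

theorem sum_add_mul_star_le (s : Finset ι) (x y : ι → A) :
    ∑ i ∈ s, (x i + y i) * star (x i + y i) ≤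
      (2 : ℝ) • ∑ i ∈ s, x i * star (x i) + (2 : ℝ) • ∑ i ∈ s, y i * star (y i) := by
  rw [Finset.smul_sum, Finset.smul_sum, ← Finset.sum_add_distrib]
  refine Finset.sum_le_sum fun i _ => ?_
  rw [← sub_nonneg]
  have h : (2 : ℝ) • (x i * star (x i)) + (2 : ℝ) • (y i * star (y i))
      - (x i + y i) * star (x i + y i) = (x i - y i) * star (x i - y i) := by
    simp only [star_add, star_sub, two_smul]
    noncomm_ring
  rw [h]
  exact mul_star_self_nonneg _

theorem norm_sum_add_mul_star_le (s : Finset ι) (x y : ι → A) :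
    ‖∑ i ∈ s, (x i + y i) * star (x i + y i)‖ ≤
      2 * ‖∑ i ∈ s, x i * star (x i)‖ + 2 * ‖∑ i ∈ s, y i * star (y i)‖ := by
  refine (CStarAlgebra.norm_le_norm_of_nonneg_of_le
    (Finset.sum_nonneg fun i _ => mul_star_self_nonneg _) (sum_add_mul_star_le s x y)).trans ?_
  refine (norm_add_le _ _).trans ?_
  simp [norm_smul]

theorem summable_add_mul_star {x y : ι → A} (hx : Summable fun i => x i * star (x i))
    (hy : Summable fun i => y i * star (y i)) :
    Summable fun i => (x i + y i) * star (x i + y i) := by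
  rw [summable_iff_vanishing_norm] at *
  intro ε hε
  obtain ⟨s, hs⟩ := hx (ε / 4) (by positivity)
  obtain ⟨t, ht⟩ := hy (ε / 4) (by positivity)
  classical
  refine ⟨s ∪ t, fun r hr => ?_⟩
  rw [Finset.disjoint_union_right] at hr
  have h1 := hs r hr.1
  have h2 := ht r hr.2
  have h3 := norm_sum_add_mul_star_le r x y
  linarith

/-- Polarization: the series defining the inner product converges. -/
theorem summable_mul_star {x y : ι → A} (hx : Summable fun i => x i * star (x i))
    (hy : Summable fun i => y i * star (y i)) : Summable fun i => y i * star (x i) := by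
  have h1 := summable_add_mul_star hy hx
  have h2 := summable_add_mul_star hy (summable_csmul_mul_star Complex.I hx)
  have key := ((h1.sub hx).sub hy).const_smul (1 / 2 : ℂ) |>.add
    (((h2.sub hx).sub hy).const_smul (Complex.I / 2))
  refine key.congr fun i => ?_
  simp only [star_add, star_smul, mul_add, add_mul, smul_mul_assoc, mul_smul_comm, smul_smul,
    Complex.star_def, Complex.conj_I, smul_sub, smul_add, mul_neg, neg_mul, Complex.I_mul_I]
  match_scalars <;> ring_nf <;> simp <;> norm_num

end Sums

section StandardModule

variable (A : Type u) [CStarAlgebra A] [PartialOrder A] [StarOrderedRing A]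

/-- The sequences `(xᵢ)` in `A` for which `∑ xᵢ xᵢ⋆` converges in norm, as a left `A`-module.
(For series of positive elements of a C⋆-algebra, convergence in norm of the sequence of partial
sums is the same as summability.) -/
def squareSummable : Submodule A (ℕ → A) where
  carrier := {x | Summable fun i => x i * star (x i)}
  add_mem' hx hy := summable_add_mul_star hx hy
  zero_mem' := by simp
  smul_mem' a _ hx := summable_smul_mul_star a hx

/-- The standard countably generated Hilbert module `H_A`. As everywhere in Mathlib, Hilbert
modules are left modules whose inner product is `A`-linear in the second variable. -/
def StdModule : Type u := squareSummable A

namespace StdModule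

noncomputable instance : AddCommGroup (StdModule A) :=
  inferInstanceAs (AddCommGroup (squareSummable A))

noncomputable instance : Module A (StdModule A) :=
  inferInstanceAs (Module A (squareSummable A))

noncomputable instance : Module ℂ (StdModule A) :=
  inferInstanceAs (Module ℂ (squareSummable A))

instance : IsScalarTower ℂ A (StdModule A) :=
  inferInstanceAs (IsScalarTower ℂ A (squareSummable A))

variable {A}

/-- The `i`-th coordinate. -/
def coord (x : StdModule A) (i : ℕ) : A := (x : squareSummable A).1 i

@[ext] theorem ext {x y : StdModule A} (h : ∀ i, coord x i = coord y i) : x = y :=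
  Subtype.ext (funext h)

@[simp] theorem coord_add (x y : StdModule A) (i : ℕ) :
    coord (x + y) i = coord x i + coord y i := rfl
@[simp] theorem coord_sub (x y : StdModule A) (i : ℕ) :
    coord (x - y) i = coord x i - coord y i := rfl
@[simp] theorem coord_zero (i : ℕ) : coord (0 : StdModule A) i = 0 := rfl
@[simp] theorem coord_smul (a : A) (x : StdModule A) (i : ℕ) :
    coord (a • x) i = a * coord x i := rfl
@[simp] theorem coord_csmul (c : ℂ) (x : StdModule A) (i : ℕ) :
    coord (c • x) i = c • coord x i := rfl

theorem summable_self (x : StdModule A) : Summable fun i => coord x i * star (coord x i) :=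
  (x : squareSummable A).2

theorem summable_inner (x y : StdModule A) : Summable fun i => coord y i * star (coord x i) :=
  summable_mul_star x.summable_self y.summable_self

noncomputable instance : Norm (StdModule A) where
  norm x := √‖∑' i, coord x i * star (coord x i)‖

/-- `⟪x, y⟫ = ∑ yᵢ xᵢ⋆`. -/
noncomputable instance : CStarModule A (StdModule A) where
  inner x y := ∑' i, coord y i * star (coord x i)
  inner_add_right {x y z} := by
    simp only [coord_add, add_mul]
    exact (summable_inner x y).tsum_add (summable_inner x z)
  inner_self_nonneg := tsum_nonneg fun i => mul_star_self_nonneg _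
  inner_self {x} := by
    refine ⟨fun h => ?_, fun h => by simp [h]⟩
    ext i
    have h1 := x.summable_self.le_tsum i fun j _ => mul_star_self_nonneg _
    rw [h] at h1
    simpa using (CStarRing.mul_star_self_eq_zero_iff _).1
      (le_antisymm h1 (mul_star_self_nonneg _))
  inner_op_smul_right {a x y} := by
    simp only [coord_smul, mul_assoc]
    exact (summable_inner x y).tsum_mul_left a
  inner_smul_right_complex {z x y} := by
    simp only [coord_csmul, smul_mul_assoc]
    exact (summable_inner x y).tsum_const_smul z
  star_inner x y := by
    rw [tsum_star]
    simp
  norm_eq_sqrt_norm_inner_self _ := rfl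

noncomputable instance : NormedAddCommGroup (StdModule A) := CStarModule.normedAddCommGroup A

noncomputable instance : NormedSpace ℂ (StdModule A) := .ofCore (CStarModule.normedSpaceCore A)

theorem norm_sum_le (s : Finset ℕ) (x : StdModule A) :
    ‖∑ i ∈ s, coord x i * star (coord x i)‖ ≤ ‖x‖ ^ 2 := by
  rw [CStarModule.norm_sq_eq A]
  exact CStarAlgebra.norm_le_norm_of_nonneg_of_le
    (Finset.sum_nonneg fun i _ => mul_star_self_nonneg _)
    (x.summable_self.sum_le_tsum s fun i _ => mul_star_self_nonneg _)

theorem norm_coord_le (x : StdModule A) (i : ℕ) : ‖coord x i‖ ≤ ‖x‖ := by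
  have h := norm_sum_le {i} x
  rw [Finset.sum_singleton, CStarRing.norm_self_mul_star, ← sq] at h
  exact le_of_sq_le_sq h (norm_nonneg _)

instance : CompleteSpace (StdModule A) := by
  refine Metric.complete_of_cauchySeq_tendsto fun u hu => ?_
  have hc : ∀ i, CauchySeq fun n => coord (u n) i := fun i => by
    rw [Metric.cauchySeq_iff] at hu ⊢
    intro ε hε
    obtain ⟨N, hN⟩ := hu ε hε
    refine ⟨N, fun m hm n hn => lt_of_le_of_lt ?_ (hN m hm n hn)⟩
    rw [dist_eq_norm, dist_eq_norm, ← coord_sub]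
    exact norm_coord_le _ i
  choose x hx using fun i => cauchySeq_tendsto_of_complete (hc i)
  have key : ∀ ε > 0, ∃ N, ∀ n ≥ N, ∀ s : Finset ℕ,
      ‖∑ i ∈ s, (x i - coord (u n) i) * star (x i - coord (u n) i)‖ ≤ ε ^ 2 := by
    intro ε hε
    obtain ⟨N, hN⟩ := (Metric.cauchySeq_iff.1 hu) ε hε
    refine ⟨N, fun n hn s => ?_⟩
    have hl : Filter.Tendsto
        (fun m => ‖∑ i ∈ s, coord (u m - u n) i * star (coord (u m - u n) i)‖) Filter.atTop
        (𝓝 ‖∑ i ∈ s, (x i - coord (u n) i) * star (x i - coord (u n) i)‖) := by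
      refine (tendsto_finsetSum _ fun i _ => ?_).norm
      have h1 : Filter.Tendsto (fun m => coord (u m - u n) i) Filter.atTop
          (𝓝 (x i - coord (u n) i)) := by
        simpa only [coord_sub] using (hx i).sub_const _
      exact h1.mul h1.star
    refine le_of_tendsto hl (Filter.eventually_atTop.2 ⟨N, fun m hm => ?_⟩)
    refine (norm_sum_le s _).trans ?_
    have h2 := hN m hm n hn
    rw [dist_eq_norm] at h2
    gcongr
  have hxs : Summable fun i => x i * star (x i) := by
    obtain ⟨N, hN⟩ := key 1 one_pos
    have hd : Summable fun i => (x i - coord (u N) i) * star (x i - coord (u N) i) := by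
      rw [summable_iff_vanishing_norm]
      intro ε hε
      obtain ⟨M, hM⟩ := key (√(ε / 8)) (by positivity)
      have hs := (u M - u N).summable_self
      rw [summable_iff_vanishing_norm] at hs
      obtain ⟨s, hs⟩ := hs (ε / 8) (by positivity)
      refine ⟨s, fun t ht => ?_⟩
      have h1 := hs t ht
      have h2 := hM M le_rfl t
      rw [Real.sq_sqrt (by positivity)] at h2
      have h3 := norm_sum_add_mul_star_le t (fun i => x i - coord (u M) i)
        (fun i => coord (u M - u N) i)
      simp only [coord_sub, sub_add_sub_cancel] at h3 h1
      linarith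
    have := summable_add_mul_star hd (u N).summable_self
    simpa using this
  let y : StdModule A := (⟨x, hxs⟩ : squareSummable A)
  refine ⟨y, Metric.tendsto_atTop.2 fun ε hε => ?_⟩
  obtain ⟨N, hN⟩ := key (ε / 2) (by positivity)
  refine ⟨N, fun n hn => ?_⟩
  rw [dist_comm, dist_eq_norm]
  have h1 : ‖y - u n‖ ^ 2 ≤ (ε / 2) ^ 2 := by
    rw [CStarModule.norm_sq_eq A]
    exact le_of_tendsto ((y - u n).summable_self.hasSum.norm)
      (Filter.Eventually.of_forall fun s => hN n hn s)
  have h2 := le_of_sq_le_sq h1 (by positivity)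
  linarith

end StdModule

end StandardModule

/-! ### The group `K(A)` -/

section KGroup

open WithCStarModule

variable (A : Type u) [CStarAlgebra A] [PartialOrder A] [StarOrderedRing A]

/-- A finitely generated Hilbert `A`-module. -/
structure FGHilbertModule where
  carrier : Type u
  [normedAddCommGroup : NormedAddCommGroup carrier]
  [normedSpace : NormedSpace ℂ carrier]
  [module : Module A carrier]
  [cstarModule : CStarModule A carrier]
  [complete : CompleteSpace carrier]
  [finite : Module.Finite A carrier]

attribute [instance] FGHilbertModule.normedAddCommGroup FGHilbertModule.normedSpace
  FGHilbertModule.module FGHilbertModule.cstarModule FGHilbertModule.complete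
  FGHilbertModule.finite

namespace FGHilbertModule

/-- Isomorphism of Hilbert modules: a bounded `A`-linear bijection with bounded inverse. -/
instance setoid : Setoid (FGHilbertModule A) where
  r M N := Nonempty (M.carrier ≃L[A] N.carrier)
  iseqv := ⟨fun _ => ⟨.refl A _⟩, fun ⟨e⟩ => ⟨e.symm⟩, fun ⟨e⟩ ⟨f⟩ => ⟨e.trans f⟩⟩

variable {A}

/-- The orthogonal direct sum. -/
noncomputable def sum (M N : FGHilbertModule A) : FGHilbertModule A where
  carrier := C⋆ᵐᵒᵈ(A, M.carrier × N.carrier)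

/-- The direct sum is, as a topological module, the product. -/
noncomputable def sumEquiv (M N : FGHilbertModule A) :
    (M.sum N).carrier ≃L[A] M.carrier × N.carrier :=
  let e : C⋆ᵐᵒᵈ(A, M.carrier × N.carrier) ≃L[A] M.carrier × N.carrier := equivL A
  e

/-- The zero module. -/
noncomputable def zero : FGHilbertModule A :=
  letI : CStarModule A PUnit.{u + 1} :=
    { inner := fun _ _ => 0
      inner_add_right := by simp
      inner_self_nonneg := le_rfl
      inner_self := by simp
      inner_op_smul_right := by simp
      inner_smul_right_complex := by simp
      star_inner := by simp
      norm_eq_sqrt_norm_inner_self := by simp }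
  { carrier := PUnit.{u + 1} }

instance : Unique (zero : FGHilbertModule A).carrier := inferInstanceAs (Unique PUnit)

end FGHilbertModule

/-- Isomorphism classes of finitely generated Hilbert `A`-modules. -/
def FGClass : Type (u + 1) := Quotient (FGHilbertModule.setoid A)

noncomputable instance : Add (FGClass A) where
  add := Quotient.map₂ FGHilbertModule.sum fun M M' ⟨e⟩ N N' ⟨f⟩ =>
    ⟨(M.sumEquiv N).trans ((e.prodCongr f).trans (M'.sumEquiv N').symm)⟩

noncomputable instance : Zero (FGClass A) where
  zero := Quotient.mk _ FGHilbertModule.zero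

noncomputable instance : AddCommMonoid (FGClass A) where
  add_assoc := by
    rintro ⟨M⟩ ⟨N⟩ ⟨P⟩
    exact Quotient.sound ⟨((M.sum N).sumEquiv P).trans <|
      ((M.sumEquiv N).prodCongr (.refl A _)).trans <|
      (ContinuousLinearEquiv.prodAssoc A _ _ _).trans <|
      ((ContinuousLinearEquiv.refl A _).prodCongr (N.sumEquiv P).symm).trans <|
      (M.sumEquiv (N.sum P)).symm⟩
  zero_add := by
    rintro ⟨M⟩
    exact Quotient.sound ⟨(FGHilbertModule.zero.sumEquiv M).trans <|
      ContinuousLinearEquiv.uniqueProd A _ _⟩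
  add_zero := by
    rintro ⟨M⟩
    exact Quotient.sound ⟨(M.sumEquiv FGHilbertModule.zero).trans <|
      ContinuousLinearEquiv.prodUnique A _ _⟩
  add_comm := by
    rintro ⟨M⟩ ⟨N⟩
    exact Quotient.sound ⟨(M.sumEquiv N).trans <|
      (ContinuousLinearEquiv.prodComm A _ _).trans (N.sumEquiv M).symm⟩
  nsmul := nsmulRec

/-- `K(A)`: the Grothendieck group of the monoid of isomorphism classes of finitely generated
Hilbert `A`-modules under direct sum. -/
abbrev KGroup : Type (u + 1) := Algebra.GrothendieckAddGroup (FGClass A)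

variable {A}

/-- A Hilbert module structure on a submodule of `H_A`, by restriction. -/
noncomputable instance (N : Submodule A (StdModule A)) : CStarModule A N where
  inner x y := inner A (x : StdModule A) (y : StdModule A)
  inner_add_right := CStarModule.inner_add_right
  inner_self_nonneg := CStarModule.inner_self_nonneg
  inner_self {x} := by simp [CStarModule.inner_self]
  inner_op_smul_right := CStarModule.inner_op_smul_right
  inner_smul_right_complex := CStarModule.inner_smul_right_complex
  star_inner _ _ := CStarModule.star_inner _ _
  norm_eq_sqrt_norm_inner_self x :=
    CStarModule.norm_eq_sqrt_norm_inner_self (A := A) (x : StdModule A)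

/-- The class `[N]` in `K(A)` of a finitely generated closed submodule `N` of `H_A`. -/
noncomputable def kClass (N : Submodule A (StdModule A)) (hc : IsClosed (N : Set (StdModule A)))
    (hf : N.FG) : KGroup A :=
  haveI : CompleteSpace N := hc.completeSpace_coe
  haveI : Module.Finite A N := Module.Finite.iff_fg.2 hf
  Algebra.GrothendieckAddGroup.of (Quotient.mk (FGHilbertModule.setoid A) { carrier := N })

variable (A) in
/-- The cancellation property of `K(A)`: `[M] = [N]` implies `M ≅ N` for finitely generated closed
submodules of `H_A`. -/
def HasCancellation : Prop :=
  ∀ (M N : Submodule A (StdModule A)) (hMc : IsClosed (M : Set (StdModule A))) (hM : M.FG)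
    (hNc : IsClosed (N : Set (StdModule A))) (hN : N.FG),
    kClass M hMc hM = kClass N hNc hN → Nonempty (M ≃L[A] N)

end KGroup

/-! ### Classes of semi-Fredholm operators -/

section Operators

variable {A : Type u} [CStarAlgebra A] [PartialOrder A] [StarOrderedRing A]

/-- A bounded `A`-linear operator on `H_A` is adjointable. -/
def IsAdjointable (F : StdModule A →L[A] StdModule A) : Prop :=
  ∃ G : StdModule A →L[A] StdModule A, ∀ x y, inner A (F x) y = inner A x (G y)

/-- `H_A = M₁ ⊕̃ N₁ → M₂ ⊕̃ N₂ = H_A` are (not necessarily orthogonal) decompositions into closed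
submodules with respect to which `F` has a diagonal matrix whose first entry is an isomorphism
`M₁ → M₂`. -/
structure IsDecomposition (F : StdModule A →L[A] StdModule A)
    (M₁ N₁ M₂ N₂ : Submodule A (StdModule A)) : Prop where
  closed_M₁ : IsClosed (M₁ : Set (StdModule A))
  closed_N₁ : IsClosed (N₁ : Set (StdModule A))
  closed_M₂ : IsClosed (M₂ : Set (StdModule A))
  closed_N₂ : IsClosed (N₂ : Set (StdModule A))
  isCompl₁ : IsCompl M₁ N₁
  isCompl₂ : IsCompl M₂ N₂
  iso : ∃ e : M₁ ≃L[A] M₂, ∀ x : M₁, (e x : StdModule A) = F x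
  mapsTo : ∀ x ∈ N₁, F x ∈ N₂

/-- `M ⪯ N`: the module `M` is isomorphic to a closed submodule of `N`. -/
def IsSubordinate (M N : Submodule A (StdModule A)) : Prop :=
  ∃ L : Submodule A (StdModule A),
    IsClosed (L : Set (StdModule A)) ∧ L ≤ N ∧ Nonempty (M ≃L[A] L)

variable (A)

/-- Upper semi-`A`-Fredholm operators. -/
def MPhiPlus : Set (StdModule A →L[A] StdModule A) :=
  {F | IsAdjointable F ∧ ∃ M₁ N₁ M₂ N₂, IsDecomposition F M₁ N₁ M₂ N₂ ∧ N₁.FG}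

/-- Lower semi-`A`-Fredholm operators. -/
def MPhiMinus : Set (StdModule A →L[A] StdModule A) :=
  {F | IsAdjointable F ∧ ∃ M₁ N₁ M₂ N₂, IsDecomposition F M₁ N₁ M₂ N₂ ∧ N₂.FG}

/-- `A`-Fredholm operators. -/
def MPhi : Set (StdModule A →L[A] StdModule A) :=
  {F | IsAdjointable F ∧ ∃ M₁ N₁ M₂ N₂, IsDecomposition F M₁ N₁ M₂ N₂ ∧ N₁.FG ∧ N₂.FG}

variable {A}

/-- `k = [N₁] - [N₂]` for some Fredholm decomposition of `F`. -/
def HasIndex (F : StdModule A →L[A] StdModule A) (k : KGroup A) : Prop :=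
  ∃ (M₁ N₁ M₂ N₂ : Submodule A (StdModule A)) (h : IsDecomposition F M₁ N₁ M₂ N₂)
    (h₁ : N₁.FG) (h₂ : N₂.FG), k = kClass N₁ h.closed_N₁ h₁ - kClass N₂ h.closed_N₂ h₂

theorem exists_hasIndex {F : StdModule A →L[A] StdModule A} (hF : F ∈ MPhi A) :
    ∃ k, HasIndex F k := by
  obtain ⟨-, M₁, N₁, M₂, N₂, h, h₁, h₂⟩ := hF
  exact ⟨_, M₁, N₁, M₂, N₂, h, h₁, h₂, rfl⟩

/-- The index of an `A`-Fredholm operator: `[N₁] - [N₂]` in `K(A)` for a Fredholm decomposition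
(the value does not depend on the decomposition). -/
noncomputable def index (F : StdModule A →L[A] StdModule A) (hF : F ∈ MPhi A) : KGroup A :=
  (exists_hasIndex hF).choose

variable (A)

/-- `A`-Fredholm operators of index zero. -/
def MPhiZero : Set (StdModule A →L[A] StdModule A) :=
  {F | ∃ hF : F ∈ MPhi A, index F hF = 0}

/-- The class `ℳ̃Φ₊⁻`: `A`-Fredholm operators with a Fredholm decomposition where `N₁ ⪯ N₂`. -/
def MPhiTildePlusMinus : Set (StdModule A →L[A] StdModule A) :=
  {F | F ∈ MPhi A ∧ ∃ M₁ N₁ M₂ N₂, IsDecomposition F M₁ N₁ M₂ N₂ ∧ N₁.FG ∧ N₂.FG ∧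
    IsSubordinate N₁ N₂}

/-- The class `ℳ̃Φ₋⁺`: `A`-Fredholm operators with a Fredholm decomposition where `N₂ ⪯ N₁`. -/
def MPhiTildeMinusPlus : Set (StdModule A →L[A] StdModule A) :=
  {F | F ∈ MPhi A ∧ ∃ M₁ N₁ M₂ N₂, IsDecomposition F M₁ N₁ M₂ N₂ ∧ N₁.FG ∧ N₂.FG ∧
    IsSubordinate N₂ N₁}

/-- The class `ℳΦ₊⁻`. -/
def MPhiPlusMinus : Set (StdModule A →L[A] StdModule A) :=
  MPhiTildePlusMinus A ∪ (MPhiPlus A \ MPhi A)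

/-- The class `ℳΦ₋⁺`. -/
def MPhiMinusPlus : Set (StdModule A →L[A] StdModule A) :=
  MPhiTildeMinusPlus A ∪ (MPhiMinus A \ MPhi A)

variable {A}

theorem norm_smul_le_mul_norm (a : A) (x : StdModule A) : ‖a • x‖ ≤ ‖a‖ * ‖x‖ := by
  refine le_of_sq_le_sq ?_ (by positivity)
  rw [CStarModule.norm_sq_eq A, mul_pow, CStarModule.norm_sq_eq A (x := x)]
  simp only [CStarModule.inner_op_smul_right, CStarModule.inner_op_smul_left]
  calc ‖a * (inner A x x * star a)‖ ≤ ‖a‖ * (‖inner A x x‖ * ‖star a‖) :=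
        (norm_mul_le _ _).trans (by gcongr; exact norm_mul_le _ _)
    _ = ‖a‖ ^ 2 * ‖inner A x x‖ := by rw [norm_star]; ring

/-- The operator `αI` on `H_A` for `α` in the center of `A`. -/
noncomputable def scalarOp (α : Subalgebra.center ℂ A) : StdModule A →L[A] StdModule A where
  toFun x := (α : A) • x
  map_add' x y := smul_add _ x y
  map_smul' a x := by
    simp only [RingHom.id_apply, smul_smul]
    rw [(Subalgebra.mem_center_iff.1 α.2 a)]
  cont := by
    refine (AddMonoidHomClass.continuous_of_bound
      (DistribSMul.toAddMonoidHom (StdModule A) (α : A)) ‖(α : A)‖ fun x => ?_)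
    exact norm_smul_le_mul_norm _ x

/-- For a class `𝒞` of operators, the set of all `α` in the center of `A` with `F - αI ∉ 𝒞`. -/
def spectrumOf (C : Set (StdModule A →L[A] StdModule A)) (F : StdModule A →L[A] StdModule A) :
    Set (Subalgebra.center ℂ A) :=
  {α | F - scalarOp α ∉ C}

variable (F : StdModule A →L[A] StdModule A)

/-- `σ_ew(F)` -/
def sigmaEW : Set (Subalgebra.center ℂ A) := spectrumOf (MPhiZero A) F

/-- `σ_eα(F)` -/
def sigmaEAlpha : Set (Subalgebra.center ℂ A) := spectrumOf (MPhiPlus A) F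

/-- `σ_eβ(F)` -/
def sigmaEBeta : Set (Subalgebra.center ℂ A) := spectrumOf (MPhiMinus A) F

/-- `σ_eã(F)` -/
def sigmaEATilde : Set (Subalgebra.center ℂ A) := spectrumOf (MPhiTildePlusMinus A) F

/-- `σ_ea(F)` -/
def sigmaEA : Set (Subalgebra.center ℂ A) := spectrumOf (MPhiPlusMinus A) F

/-- `σ_eb̃(F)` -/
def sigmaEBTilde : Set (Subalgebra.center ℂ A) := spectrumOf (MPhiTildeMinusPlus A) F

/-- `σ_eb(F)` -/
def sigmaEB : Set (Subalgebra.center ℂ A) := spectrumOf (MPhiMinusPlus A) F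

end Operators

end HilbertFredholm

/-!
Each class of operators gives a set of central elements `α`, the complement of its spectrum, and each
inclusion compares the boundaries of the complements of two such sets `U ⊆ V`. It holds as soon as
`U` is open and relatively closed in `V` (`frontier_compl_subset`), so the theorem is a statement
about the stability of decompositions when `α` moves a little.

The decompositions of `F` are the same thing as outer inverses `G` of `F`, operators with
`GFG = G`: the defects of the decomposition are `N₁ = ker GF` and `N₂ = ker G`. Everything is proved
by algebra with outer inverses.

* Stability (`IsOuterInverse.perturb`): if `F'` is close to `F`, then `U = 1 + G(F' - F)` is
  invertible and `U⁻¹G` is an outer inverse of `F'` with the same `N₂` and an isomorphic `N₁`.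
* Comparison (`IsOuterInverse.nonempty_prod_equiv`): for two outer inverses of the same operator,
  `N₁ ⊕ N₂' ≅ N₂ ⊕ N₁'`. Hence the index is well defined and locally constant, and an operator which
  is semi-Fredholm and a limit of Fredholm operators is Fredholm.
* Stabilization (`IsOuterInverse.stabilize`): a finitely generated Hilbert module can be added to
  both `N₁` and `N₂`. An operator of index zero thus has a decomposition with `N₁ ≅ N₂`, and belongs
  to both classes `ℳ̃Φ₊⁻` and `ℳ̃Φ₋⁺`.
* Cancellation (`HasCancellation.isRetract`): under the cancellation property, the relation
  `N₁ ⪯ N₂` passes from one decomposition to any other one, hence to limits that are Fredholm.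

The analytic input is that a finitely generated Hilbert module is a direct summand of `H_A`, and
complemented wherever it is a closed submodule of `H_A`. This follows from the invertibility of the
frame operator `x ↦ ∑ ⟪gᵢ, x⟫ gᵢ` of a finite family of generators (`isUnit_frameOp`).
-/

namespace HilbertFredholm

/-! ### Invertibility of operators -/

section Invertibility

/-- A bounded operator on a Banach space whose translates by nonnegative real numbers are
bounded below with a common constant is invertible: the translates by large numbers are
invertible by the Neumann series, and invertibility propagates from one translate to all those
within a fixed distance. -/
theorem isUnit_of_uniformly_bounded_below {E : Type*} [NormedAddCommGroup E] [NormedSpace ℂ E]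
    [CompleteSpace E] (K : E →L[ℂ] E) {C : ℝ} (hC : 0 < C)
    (h : ∀ t : ℝ, 0 ≤ t → ∀ x, ‖x‖ ≤ C * ‖K x + (t : ℂ) • x‖) : IsUnit K := by
  set S : ℝ → (E →L[ℂ] E) := fun t => K + (t : ℂ) • 1 with hS
  have step : ∀ s t : ℝ, 0 ≤ t → |s - t| * C < 1 → IsUnit (S t) → IsUnit (S s) := by
    rintro s t ht hst ⟨V, hV⟩
    have hVn : ‖(↑V⁻¹ : E →L[ℂ] E)‖ ≤ C := by
      refine ContinuousLinearMap.opNorm_le_bound _ hC.le fun y => ?_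
      have h1 := h t ht ((↑V⁻¹ : E →L[ℂ] E) y)
      have h2 : S t ((↑V⁻¹ : E →L[ℂ] E) y) = y := by
        rw [← hV]
        exact congrArg (fun f : E →L[ℂ] E => f y) V.mul_inv
      have h3 : K ((↑V⁻¹ : E →L[ℂ] E) y) + (t : ℂ) • (↑V⁻¹ : E →L[ℂ] E) y = y := by
        exact h2
      rwa [h3] at h1
    have hn : ‖((t - s : ℝ) : ℂ) • (↑V⁻¹ : E →L[ℂ] E)‖ < 1 := by
      rw [norm_smul, Complex.norm_real, Real.norm_eq_abs, abs_sub_comm]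
      exact lt_of_le_of_lt (by gcongr) hst
    have h4 := V.isUnit.mul (isUnit_one_sub_of_norm_lt_one hn)
    convert! h4 using 1
    rw [mul_sub, mul_one, mul_smul_comm, Units.mul_inv, hV]
    simp only [hS]
    push_cast
    module
  have down : ∀ n : ℕ, IsUnit (S (n * (2 * C)⁻¹)) → IsUnit (S 0) := by
    intro n
    induction n with
    | zero => simp
    | succ n ih =>
      refine fun hn => ih (step _ _ (by positivity) ?_ hn)
      have : (n : ℝ) * (2 * C)⁻¹ - ((n + 1 : ℕ) : ℝ) * (2 * C)⁻¹ = -(2 * C)⁻¹ := by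
        push_cast; ring
      rw [this, abs_neg, abs_of_pos (by positivity), mul_inv, mul_assoc, inv_mul_cancel₀ hC.ne']
      norm_num
  have large : ∀ t : ℝ, ‖K‖ < t → IsUnit (S t) := by
    intro t ht
    have ht0 : 0 < t := (norm_nonneg _).trans_lt ht
    have htc : (t : ℂ) ≠ 0 := by exact_mod_cast ht0.ne'
    have hn : ‖-((t : ℂ)⁻¹ • K)‖ < 1 := by
      rw [norm_neg, norm_smul, norm_inv, Complex.norm_real, Real.norm_eq_abs, abs_of_pos ht0,
        inv_mul_lt_one₀ ht0]
      exact ht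
    have h1 := (isUnit_one_sub_of_norm_lt_one hn).smul (Units.mk0 (t : ℂ) htc)
    convert! h1 using 1
    rw [Units.smul_mk0, sub_neg_eq_add, smul_add, smul_smul, mul_inv_cancel₀ htc, one_smul]
    exact add_comm _ _
  obtain ⟨n, hn⟩ := exists_nat_gt (‖K‖ * (2 * C))
  have := down n (large _ (by rwa [← div_eq_mul_inv, lt_div_iff₀ (by positivity)]))
  simpa [hS] using this

variable {A : Type u} [CStarAlgebra A]
  {E : Type*} [NormedAddCommGroup E] [NormedSpace ℂ E] [Module A E]
  [IsScalarTower ℂ A E]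

/-- An `A`-linear operator that is invertible as a `ℂ`-linear operator has an `A`-linear
inverse. -/
theorem isUnit_of_isUnit_restrictScalars {T : E →L[A] E}
    (h : IsUnit (T.restrictScalars ℂ : E →L[ℂ] E)) : IsUnit T := by
  obtain ⟨V, hV⟩ := h
  have h1 : ∀ x, T ((↑V⁻¹ : E →L[ℂ] E) x) = x := fun x => by
    have := congrArg (fun f : E →L[ℂ] E => f x) V.mul_inv
    rwa [hV] at this
  have h2 : ∀ x, (↑V⁻¹ : E →L[ℂ] E) (T x) = x := fun x => by
    have := congrArg (fun f : E →L[ℂ] E => f x) V.inv_mul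
    rwa [hV] at this
  let W : E →L[A] E :=
    { toFun := (↑V⁻¹ : E →L[ℂ] E)
      map_add' := map_add _
      map_smul' := fun a x => by
        conv_lhs => rw [← h1 x, ← map_smul, h2]
        rfl
      cont := (↑V⁻¹ : E →L[ℂ] E).continuous }
  exact ⟨⟨T, W, ContinuousLinearMap.ext h1, ContinuousLinearMap.ext h2⟩, rfl⟩

/-- The Neumann series for `A`-linear operators. -/
theorem isUnit_one_add_of_bound [CompleteSpace E] (T : E →L[A] E) {r : ℝ} (hr0 : 0 ≤ r) (hr : r < 1)
    (hT : ∀ x, ‖T x‖ ≤ r * ‖x‖) : IsUnit (1 + T) := by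
  refine isUnit_of_isUnit_restrictScalars ?_
  have hn : ‖-(T.restrictScalars ℂ : E →L[ℂ] E)‖ < 1 := by
    rw [norm_neg]
    exact (ContinuousLinearMap.opNorm_le_bound _ hr0 hT).trans_lt hr
  convert! isUnit_one_sub_of_norm_lt_one hn using 1
  rw [sub_neg_eq_add]
  rfl

end Invertibility

/-! ### Finitely generated Hilbert modules -/

section FinitelyGenerated

variable {A : Type u} [CStarAlgebra A] [PartialOrder A]
  {E : Type*} [NormedAddCommGroup E] [NormedSpace ℂ E] [Module A E] [CStarModule A E]

theorem norm_smul_le_of_cstarModule (a : A) (x : E) : ‖a • x‖ ≤ ‖a‖ * ‖x‖ := by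
  refine le_of_sq_le_sq ?_ (by positivity)
  rw [CStarModule.norm_sq_eq A, mul_pow, CStarModule.norm_sq_eq A (x := x)]
  simp only [CStarModule.inner_op_smul_right, CStarModule.inner_op_smul_left]
  calc ‖a * (inner A x x * star a)‖ ≤ ‖a‖ * (‖inner A x x‖ * ‖star a‖) :=
        (norm_mul_le _ _).trans (by gcongr; exact norm_mul_le _ _)
    _ = ‖a‖ ^ 2 * ‖inner A x x‖ := by rw [norm_star]; ring

variable (A E) in
theorem isScalarTower_of_cstarModule : IsScalarTower ℂ A E where
  smul_assoc z a x := by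
    rw [← sub_eq_zero, ← CStarModule.inner_self (A := A)]
    have h : ∀ y : E, inner A y ((z • a) • x - z • a • x) = 0 := fun y => by
      simp [CStarModule.inner_sub_right]
    exact h _

/-- The bounded `A`-linear functional `⟪x, ·⟫`. -/
noncomputable def innerRight [StarOrderedRing A] (x : E) : E →L[A] A where
  toFun y := inner A x y
  map_add' y z := by simp
  map_smul' a y := by simp
  cont := ((CStarModule.innerSL (A := A) (E := E)) x).continuous

@[simp] theorem innerRight_apply [StarOrderedRing A] (x y : E) :
    innerRight (A := A) x y = inner A x y := rfl

/-- The bounded `A`-linear map `a ↦ a x`. -/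
noncomputable def smulRight (x : E) : A →L[A] E where
  toFun a := a • x
  map_add' a b := add_smul a b x
  map_smul' a b := by simp [smul_smul]
  cont := AddMonoidHomClass.continuous_of_bound
    ((LinearMap.toSpanSingleton A E x).toAddMonoidHom) ‖x‖ fun a => by
      rw [mul_comm]; exact norm_smul_le_of_cstarModule a x

@[simp] theorem smulRight_apply (x : E) (a : A) : smulRight x a = a • x := rfl

/-- In a finitely generated Hilbert module the coefficients of an element with respect to the
generators can be chosen of controlled norm, by the open mapping theorem. -/
theorem exists_bounded_coefficients [CompleteSpace E] {m : ℕ} {g : Fin m → E}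
    (hg : Submodule.span A (Set.range g) = ⊤) :
    ∃ C : ℝ, 0 < C ∧ ∀ x : E, ∃ a : Fin m → A, ∑ i, a i • g i = x ∧ ∀ i, ‖a i‖ ≤ C * ‖x‖ := by
  have := isScalarTower_of_cstarModule A E
  let T : (Fin m → A) →L[A] E := ∑ i, (smulRight (g i)).comp (ContinuousLinearMap.proj i)
  have hT : ∀ a, T a = ∑ i, a i • g i := fun a => by simp [T]
  have hs : Function.Surjective (T.restrictScalars ℂ : (Fin m → A) →L[ℂ] E) := fun x => by
    have hx : x ∈ Submodule.span A (Set.range g) := hg ▸ Submodule.mem_top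
    obtain ⟨a, ha⟩ := (Submodule.mem_span_range_iff_exists_fun A).1 hx
    exact ⟨a, (hT a).trans ha⟩
  obtain ⟨C, hC, h⟩ := ContinuousLinearMap.exists_preimage_norm_le _ hs
  refine ⟨C, hC, fun x => ?_⟩
  obtain ⟨a, ha, hn⟩ := h x
  exact ⟨a, (hT a).symm.trans ha, fun i => (norm_le_pi_norm a i).trans hn⟩

variable [StarOrderedRing A]

/-- The frame operator `x ↦ ∑ ⟪gᵢ, x⟫ gᵢ` of a finite family. -/
noncomputable def frameOp {m : ℕ} (g : Fin m → E) : E →L[A] E :=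
  ∑ i, (smulRight (g i)).comp (innerRight (g i))

theorem frameOp_apply {m : ℕ} (g : Fin m → E) (x : E) :
    frameOp (A := A) g x = ∑ i, inner A (g i) x • g i := by
  simp [frameOp]

/-- The frame operator of a finite family of generators is invertible. With
`bᵢ = ⟪gᵢ, x⟫`, expanding `x` in the generators bounds `‖x‖` by the norms of the `bᵢ`, while
`bᵢ bᵢ⋆ ≤ ∑ bⱼ bⱼ⋆ + t ⟪x, x⟫ = ⟪x, K x + t x⟫` for the frame operator `K` and every `t ≥ 0`; hence
the operators `K + t` are bounded below uniformly in `t ≥ 0`. -/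
theorem isUnit_frameOp [CompleteSpace E] {m : ℕ} {g : Fin m → E}
    (hg : Submodule.span A (Set.range g) = ⊤) : IsUnit (frameOp (A := A) g) := by
  have := isScalarTower_of_cstarModule A E
  obtain ⟨C, hC, hcoef⟩ := exists_bounded_coefficients hg
  refine isUnit_of_isUnit_restrictScalars
    (isUnit_of_uniformly_bounded_below _ (C := (C * m) ^ 2 + 1) (by positivity) fun t ht x => ?_)
  set y : E := frameOp (A := A) g x + (t : ℂ) • x with hy
  change ‖x‖ ≤ _ * ‖y‖
  have hle : ∀ i, ‖inner A (g i) x‖ ^ 2 ≤ ‖x‖ * ‖y‖ := by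
    intro i
    have h1 : inner A x y =
        ∑ j, inner A (g j) x * star (inner A (g j) x) + (t : ℂ) • inner A x x := by
      rw [hy, CStarModule.inner_add_right, frameOp_apply, ← innerRight_apply x (∑ j, _), map_sum]
      simp
    have h0 : (0 : A) ≤ (t : ℂ) • inner A x x := by
      rw [Complex.coe_smul]
      exact smul_nonneg ht CStarModule.inner_self_nonneg
    have h2 : inner A (g i) x * star (inner A (g i) x) ≤ inner A x y := by
      rw [h1]
      refine le_add_of_le_of_nonneg ?_ h0
      exact Finset.single_le_sum (f := fun j => inner A (g j) x * star (inner A (g j) x))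
        (fun j _ => mul_star_self_nonneg _) (Finset.mem_univ i)
    calc ‖inner A (g i) x‖ ^ 2 = ‖inner A (g i) x * star (inner A (g i) x)‖ := by
          rw [CStarRing.norm_self_mul_star, sq]
      _ ≤ ‖inner A x y‖ := CStarAlgebra.norm_le_norm_of_nonneg_of_le (mul_star_self_nonneg _) h2
      _ ≤ ‖x‖ * ‖y‖ := CStarModule.norm_inner_le E
  have hx : ‖x‖ ^ 2 ≤ C * ‖x‖ * (m * √(‖x‖ * ‖y‖)) := by
    obtain ⟨a, ha, hn⟩ := hcoef x
    have h1 : inner A x x = ∑ i, a i * star (inner A (g i) x) := by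
      conv_lhs => rw [← innerRight_apply]
      nth_rewrite 2 [← ha]
      rw [map_sum]
      simp
    rw [CStarModule.norm_sq_eq A, h1]
    refine (norm_sum_le _ _).trans ?_
    refine (Finset.sum_le_sum (g := fun _ => C * ‖x‖ * √(‖x‖ * ‖y‖)) fun i _ => ?_).trans
      (le_of_eq ?_)
    · refine (norm_mul_le _ _).trans ?_
      rw [norm_star]
      gcongr
      · exact hn i
      · exact Real.le_sqrt_of_sq_le (hle i)
    · rw [Finset.sum_const, Finset.card_univ, Fintype.card_fin, nsmul_eq_mul]; ring
  rcases (norm_nonneg x).eq_or_lt with h0 | h0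
  · rw [← h0]; positivity
  have h3 : ‖x‖ ≤ C * m * √(‖x‖ * ‖y‖) := by
    refine le_of_mul_le_mul_left ?_ h0
    calc ‖x‖ * ‖x‖ = ‖x‖ ^ 2 := (sq _).symm
      _ ≤ _ := hx
      _ = _ := by ring
  have h4 : ‖x‖ ^ 2 ≤ (C * m) ^ 2 * (‖x‖ * ‖y‖) := by
    calc ‖x‖ ^ 2 ≤ (C * m * √(‖x‖ * ‖y‖)) ^ 2 := by gcongr
      _ = _ := by rw [mul_pow, Real.sq_sqrt (by positivity)]
  have h5 : ‖x‖ ≤ (C * m) ^ 2 * ‖y‖ := by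
    refine le_of_mul_le_mul_left ?_ h0
    calc ‖x‖ * ‖x‖ = ‖x‖ ^ 2 := (sq _).symm
      _ ≤ _ := h4
      _ = _ := by ring
  nlinarith [norm_nonneg y]

end FinitelyGenerated

/-! ### Coordinates and shifts on `H_A` -/

section Coordinates

theorem pi_single_mul_star {A : Type u} [CStarAlgebra A] (i : ℕ) (a : A) (j : ℕ) :
    Pi.single (M := fun _ => A) i a j * star (Pi.single (M := fun _ => A) i a j) =
      Pi.single (M := fun _ => A) i (a * star a) j := by
  rcases eq_or_ne j i with rfl | h <;> simp [*]

variable {A : Type u} [CStarAlgebra A] [PartialOrder A] [StarOrderedRing A]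

namespace StdModule

/-- The element of `H_A` with prescribed coordinates. -/
def ofCoords (x : ℕ → A) (hx : Summable fun i => x i * star (x i)) : StdModule A :=
  (⟨x, hx⟩ : squareSummable A)

@[simp] theorem coord_ofCoords (x : ℕ → A) (hx) (i : ℕ) : coord (ofCoords x hx) i = x i := rfl

theorem norm_sq_eq_norm_tsum (x : StdModule A) :
    ‖x‖ ^ 2 = ‖∑' i, coord x i * star (coord x i)‖ :=
  CStarModule.norm_sq_eq A

/-- The `i`-th coordinate as a bounded `A`-linear map. -/
noncomputable def coordL (i : ℕ) : StdModule A →L[A] A where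
  toFun x := coord x i
  map_add' _ _ := rfl
  map_smul' _ _ := rfl
  cont := AddMonoidHomClass.continuous_of_bound
    (AddMonoidHom.mk' (fun x : StdModule A => coord x i) fun _ _ => rfl) 1 fun x => by
      rw [one_mul]; exact norm_coord_le x i

@[simp] theorem coordL_apply (i : ℕ) (x : StdModule A) : coordL i x = coord x i := rfl

/-- The embedding of `A` as the `i`-th coordinate axis of `H_A`. -/
noncomputable def single (i : ℕ) : A →L[A] StdModule A :=
  let f : A →ₗ[A] StdModule A :=
    { toFun := fun a => ofCoords (Pi.single i a) (by
        simp only [pi_single_mul_star]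
        exact (hasSum_pi_single i (a * star a)).summable)
      map_add' := fun a b => ext fun j => by simp [Pi.single_add]
      map_smul' := fun a b => ext fun j => by
        rcases eq_or_ne j i with rfl | h <;> simp [*] }
  { f with
    cont := AddMonoidHomClass.continuous_of_bound f 1 fun a => by
      refine le_of_sq_le_sq ?_ (by positivity)
      rw [norm_sq_eq_norm_tsum, one_mul]
      change ‖∑' j, Pi.single (M := fun _ => A) i a j *
        star (Pi.single (M := fun _ => A) i a j)‖ ≤ _
      simp only [pi_single_mul_star]
      rw [tsum_pi_single, CStarRing.norm_self_mul_star, sq] }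

theorem coord_single (i j : ℕ) (a : A) :
    coord (single i a) j = Pi.single (M := fun _ => A) i a j := rfl

/-- The backward shift by `n` places. -/
noncomputable def shiftLeft (n : ℕ) : StdModule A →L[A] StdModule A :=
  let f : StdModule A →ₗ[A] StdModule A :=
    { toFun := fun x => ofCoords (fun i => coord x (i + n))
        ((summable_nat_add_iff n).2 x.summable_self)
      map_add' := fun _ _ => rfl
      map_smul' := fun _ _ => rfl }
  { f with
    cont := AddMonoidHomClass.continuous_of_bound f 1 fun x => by
      refine le_of_sq_le_sq ?_ (by positivity)
      rw [norm_sq_eq_norm_tsum, one_mul, norm_sq_eq_norm_tsum]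
      refine CStarAlgebra.norm_le_norm_of_nonneg_of_le
        (tsum_nonneg fun i => mul_star_self_nonneg _) ?_
      rw [← x.summable_self.sum_add_tsum_nat_add n]
      exact le_add_of_nonneg_left (Finset.sum_nonneg fun i _ => mul_star_self_nonneg _) }

@[simp] theorem coord_shiftLeft (n : ℕ) (x : StdModule A) (i : ℕ) :
    coord (shiftLeft n x) i = coord x (i + n) := rfl

/-- The forward shift by `n` places. -/
noncomputable def shiftRight (n : ℕ) : StdModule A →L[A] StdModule A :=
  have hs (x : StdModule A) : Summable fun i =>
      (if i < n then 0 else coord x (i - n)) * star (if i < n then 0 else coord x (i - n)) :=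
    (summable_nat_add_iff n).1 (by simpa using x.summable_self)
  let f : StdModule A →ₗ[A] StdModule A :=
    { toFun := fun x => ofCoords (fun i => if i < n then 0 else coord x (i - n)) (hs x)
      map_add' := fun x y => ext fun i => by
        by_cases h : i < n <;> simp [h]
      map_smul' := fun a x => ext fun i => by
        by_cases h : i < n <;> simp [h] }
  { f with
    cont := AddMonoidHomClass.continuous_of_bound f 1 fun x => by
      refine le_of_sq_le_sq ?_ (by positivity)
      rw [norm_sq_eq_norm_tsum, one_mul, norm_sq_eq_norm_tsum]
      change ‖∑' i, (if i < n then 0 else coord x (i - n)) *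
        star (if i < n then 0 else coord x (i - n))‖ ≤ _
      rw [← (hs x).sum_add_tsum_nat_add n, Finset.sum_eq_zero, zero_add]
      · simp
      · intro i hi
        simp [Finset.mem_range.1 hi] }

theorem coord_shiftRight (n : ℕ) (x : StdModule A) (i : ℕ) :
    coord (shiftRight n x) i = if i < n then 0 else coord x (i - n) := rfl

@[simp] theorem shiftLeft_shiftRight (n : ℕ) (x : StdModule A) :
    shiftLeft n (shiftRight n x) = x :=
  ext fun i => by simp [coord_shiftRight]

theorem norm_shiftRight (n : ℕ) (x : StdModule A) : ‖shiftRight n x‖ = ‖x‖ := by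
  rw [← sq_eq_sq₀ (norm_nonneg _) (norm_nonneg _), norm_sq_eq_norm_tsum, norm_sq_eq_norm_tsum,
    ← (shiftRight n x).summable_self.sum_add_tsum_nat_add n, Finset.sum_eq_zero, zero_add]
  · simp [coord_shiftRight]
  · intro i hi
    simp [coord_shiftRight, Finset.mem_range.1 hi]

theorem tendsto_shiftLeft (x : StdModule A) :
    Filter.Tendsto (fun n => shiftLeft n x) Filter.atTop (𝓝 0) := by
  rw [tendsto_zero_iff_norm_tendsto_zero]
  have h := (_root_.tendsto_sum_nat_add fun i => coord x i * star (coord x i)).norm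
  rw [norm_zero] at h
  have h2 := h.sqrt
  rw [Real.sqrt_zero] at h2
  refine h2.congr fun n => ?_
  rw [← Real.sqrt_sq (norm_nonneg (shiftLeft n x)), norm_sq_eq_norm_tsum]
  rfl

end StdModule

end Coordinates

/-! ### Finitely generated Hilbert modules as direct summands of `H_A` -/

section Summands

variable {A : Type u} [CStarAlgebra A] [PartialOrder A] [StarOrderedRing A]
  {E : Type*} [NormedAddCommGroup E] [NormedSpace ℂ E] [Module A E] [CStarModule A E]
  [CompleteSpace E]

variable (A E) in
/-- A finitely generated Hilbert module is a direct summand of `H_A`: the analysis operator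
`x ↦ (⟪gᵢ, x⟫)ᵢ` of a finite family of generators has a left inverse, since the frame operator is
invertible. -/
theorem exists_section_retraction [Module.Finite A E] :
    ∃ (S : E →L[A] StdModule A) (T : StdModule A →L[A] E), ∀ x, T (S x) = x := by
  obtain ⟨m, g, hg⟩ := Module.Finite.exists_fin (R := A) (M := E)
  obtain ⟨V, hV⟩ := isUnit_frameOp hg
  let S : E →L[A] StdModule A := ∑ i : Fin m, (StdModule.single (i : ℕ)).comp (innerRight (g i))
  let T : StdModule A →L[A] E := ∑ i : Fin m, (smulRight (g i)).comp (StdModule.coordL (i : ℕ))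
  refine ⟨S, (↑V⁻¹ : E →L[A] E).comp T, fun x => ?_⟩
  have h : T (S x) = (V : E →L[A] E) x := by
    rw [hV, frameOp_apply]
    simp only [T, _root_.sum_apply, ContinuousLinearMap.comp_apply, smulRight_apply]
    refine Finset.sum_congr rfl fun i _ => ?_
    congr 1
    simp only [S, _root_.sum_apply, ContinuousLinearMap.comp_apply, map_sum,
      StdModule.coordL_apply, StdModule.coord_single, innerRight_apply]
    rw [Finset.sum_eq_single i]
    · simp
    · intro j _ hj
      rw [Pi.single_eq_of_ne]
      exact fun h => hj (Fin.ext h.symm)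
    · simp
  rw [ContinuousLinearMap.comp_apply, h]
  exact congrArg (fun f : E →L[A] E => f x) V.inv_mul

/-- A finitely generated closed submodule of `H_A` is the range of a bounded projection. -/
theorem exists_projection {N : Submodule A (StdModule A)}
    (hc : IsClosed (N : Set (StdModule A))) (hN : N.FG) :
    ∃ p : StdModule A →L[A] StdModule A, (∀ x, p x ∈ N) ∧ ∀ x ∈ N, p x = x := by
  have : CompleteSpace N := hc.completeSpace_coe
  have : Module.Finite A N := Module.Finite.iff_fg.2 hN
  obtain ⟨m, g, hg⟩ := Module.Finite.exists_fin (R := A) (M := N)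
  obtain ⟨V, hV⟩ := isUnit_frameOp hg
  let T : StdModule A →L[A] N :=
    ∑ i, (smulRight (g i)).comp (innerRight (g i : StdModule A))
  have hT : ∀ x : N, T x = (V : N →L[A] N) x := fun x => by
    rw [hV, frameOp_apply]
    simp [T]
    rfl
  refine ⟨N.subtypeL.comp ((↑V⁻¹ : N →L[A] N).comp T), fun x => Subtype.property _,
    fun x hx => ?_⟩
  have h : (↑V⁻¹ : N →L[A] N) (T (⟨x, hx⟩ : N)) = ⟨x, hx⟩ := by
    rw [hT]
    exact congrArg (fun f : N →L[A] N => f ⟨x, hx⟩) V.inv_mul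
  exact congrArg Subtype.val h

/-- Backward shifts tend to zero in norm on a finitely generated closed submodule. -/
theorem exists_shiftLeft_le {N : Submodule A (StdModule A)}
    (hc : IsClosed (N : Set (StdModule A))) (hN : N.FG) {ε : ℝ} (hε : 0 < ε) :
    ∃ n, ∀ x ∈ N, ‖StdModule.shiftLeft n x‖ ≤ ε * ‖x‖ := by
  have : CompleteSpace N := hc.completeSpace_coe
  have : Module.Finite A N := Module.Finite.iff_fg.2 hN
  obtain ⟨m, g, hg⟩ := Module.Finite.exists_fin (R := A) (M := N)
  obtain ⟨C, hC, h⟩ := exists_bounded_coefficients hg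
  have ht : Filter.Tendsto (fun n => ∑ i, ‖StdModule.shiftLeft n (g i : StdModule A)‖)
      Filter.atTop (𝓝 0) := by
    rw [← Finset.sum_const_zero (s := (Finset.univ : Finset (Fin m)))]
    exact tendsto_finsetSum _ fun i _ => by
      simpa using (StdModule.tendsto_shiftLeft (g i : StdModule A)).norm
  obtain ⟨n, hn⟩ := (ht.eventually_lt_const (show 0 < ε / C by positivity)).exists
  refine ⟨n, fun x hx => ?_⟩
  obtain ⟨a, ha, hb⟩ := h ⟨x, hx⟩
  have hx' : x = ∑ i, a i • (g i : StdModule A) := by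
    simpa using (congrArg Subtype.val ha).symm
  have hxn : ∀ i, ‖a i‖ ≤ C * ‖x‖ := hb
  calc ‖StdModule.shiftLeft n x‖
      = ‖∑ i, a i • StdModule.shiftLeft n (g i : StdModule A)‖ := by
        conv_lhs => rw [hx', map_sum]
        simp
    _ ≤ ∑ i, C * ‖x‖ * ‖StdModule.shiftLeft n (g i : StdModule A)‖ := by
        refine (norm_sum_le _ _).trans (Finset.sum_le_sum fun i _ => ?_)
        refine (norm_smul_le_mul_norm _ _).trans ?_
        gcongr
        exact hxn i
    _ = C * ‖x‖ * ∑ i, ‖StdModule.shiftLeft n (g i : StdModule A)‖ := by rw [Finset.mul_sum]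
    _ ≤ C * ‖x‖ * (ε / C) := by gcongr
    _ = ε * ‖x‖ := by field_simp

end Summands

/-! ### Decompositions and outer inverses -/

section OuterInverses

variable {A : Type u} [CStarAlgebra A] [PartialOrder A] [StarOrderedRing A]
  {F F' G G' : StdModule A →L[A] StdModule A}

/-- The projection onto `M` along `N`, for complementary closed submodules, as a bounded
`A`-linear map. -/
theorem exists_projection_of_isCompl {M N : Submodule A (StdModule A)}
    (hM : IsClosed (M : Set (StdModule A))) (hN : IsClosed (N : Set (StdModule A)))
    (h : IsCompl M N) :
    ∃ p : StdModule A →L[A] M, (∀ x : M, p x = x) ∧ ∀ x, p x = 0 ↔ x ∈ N := by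
  have hc : Continuous (M.projection N h) := by
    refine LinearMap.continuous_of_seq_closed_graph
      (g := (M.projection N h).restrictScalars ℂ) fun u x y hu hy => ?_
    have hyM : y ∈ M := hM.mem_of_tendsto hy
      (Filter.Eventually.of_forall fun n => M.projection_apply_mem h (u n))
    have hyN : x - y ∈ N := hN.mem_of_tendsto (hu.sub hy)
      (Filter.Eventually.of_forall fun n => Submodule.sub_projection_mem h (u n))
    have h1 := (Submodule.projection_apply_eq_zero_iff h).2 hyN
    rw [map_sub, M.projection_apply_of_mem_left h hyM, sub_eq_zero] at h1
    exact h1.symm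
  refine ⟨⟨M.projectionOnto N h, hc.subtype_mk _⟩, fun x => M.projectionOnto_apply_left h x,
    fun x => Submodule.projectionOnto_apply_eq_zero_iff h⟩

/-- `G` is an outer inverse of `F`: `GFG = G`. The decompositions of `F` correspond to its outer
inverses: `G` is the inverse of `F : M₁ → M₂`, extended by zero on `N₂`. -/
def IsOuterInverse (F G : StdModule A →L[A] StdModule A) : Prop := ∀ x, G (F (G x)) = G x

/-- The kernel of a bounded operator on `H_A`, as an `A`-submodule. -/
noncomputable def kerOp (T : StdModule A →L[A] StdModule A) : Submodule A (StdModule A) :=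
  LinearMap.ker (T : StdModule A →ₗ[A] StdModule A)

@[simp] theorem mem_kerOp {T : StdModule A →L[A] StdModule A} {x : StdModule A} :
    x ∈ kerOp T ↔ T x = 0 := LinearMap.mem_ker

theorem isClosed_kerOp (T : StdModule A →L[A] StdModule A) :
    IsClosed (kerOp T : Set (StdModule A)) := T.isClosed_ker

theorem isCompl_kerOp {P : StdModule A →L[A] StdModule A} (hP : ∀ x, P (P x) = P x) :
    IsCompl (kerOp (1 - P)) (kerOp P) := by
  refine IsCompl.of_eq ?_ ?_
  · refine (Submodule.eq_bot_iff _).2 fun x hx => ?_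
    obtain ⟨h1, h2⟩ := Submodule.mem_inf.1 hx
    simp only [mem_kerOp, sub_apply, one_apply_eq_self] at h1 h2
    rwa [h2, sub_zero] at h1
  · refine Submodule.eq_top_iff'.2 fun x => ?_
    rw [← sub_add_cancel x (P x), add_comm]
    exact Submodule.add_mem_sup (by simp [hP]) (by simp [hP])

/-- The decomposition of `F` defined by an outer inverse. -/
theorem IsOuterInverse.isDecomposition (h : IsOuterInverse F G) :
    IsDecomposition F (kerOp (1 - G * F)) (kerOp (G * F)) (kerOp (1 - F * G)) (kerOp G) where
  closed_M₁ := isClosed_kerOp _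
  closed_N₁ := isClosed_kerOp _
  closed_M₂ := isClosed_kerOp _
  closed_N₂ := isClosed_kerOp _
  isCompl₁ := isCompl_kerOp fun x => h (F x)
  isCompl₂ := by
    have hk : kerOp G = kerOp (F * G) := by
      ext x
      refine ⟨fun hx => ?_, fun hx => ?_⟩
      · simp_all
      · rw [mem_kerOp] at hx ⊢
        rw [← h x]
        exact (congrArg G hx).trans (map_zero G)
    rw [hk]
    exact isCompl_kerOp fun x => congrArg F (h x)
  iso := by
    refine ⟨ContinuousLinearEquiv.equivOfInverse
      ((F.comp (Submodule.subtypeL _)).codRestrict _ fun x => ?_)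
      ((G.comp (Submodule.subtypeL _)).codRestrict _ fun x => ?_)
      (fun x => ?_) (fun x => ?_), fun x => rfl⟩
    · have hx : (x : StdModule A) - G (F x) = 0 := x.2
      change F x - F (G (F x)) = 0
      rw [← map_sub, hx, map_zero]
    · change G x - G (F (G x)) = 0
      rw [h, sub_self]
    · have hx : (x : StdModule A) - G (F x) = 0 := x.2
      exact Subtype.ext (sub_eq_zero.1 hx).symm
    · have hx : (x : StdModule A) - F (G x) = 0 := x.2
      exact Subtype.ext (sub_eq_zero.1 hx).symm
  mapsTo x hx := hx

/-- Every decomposition of `F` comes from an outer inverse. -/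
theorem IsDecomposition.exists_isOuterInverse {M₁ N₁ M₂ N₂ : Submodule A (StdModule A)}
    (h : IsDecomposition F M₁ N₁ M₂ N₂) :
    ∃ G, IsOuterInverse F G ∧ N₁ = kerOp (G * F) ∧ N₂ = kerOp G := by
  obtain ⟨p, hp, hp0⟩ := exists_projection_of_isCompl h.closed_M₂ h.closed_N₂ h.isCompl₂
  obtain ⟨e, he⟩ := h.iso
  have hk : ∀ x, ((e.symm (p x) : M₁) : StdModule A) = 0 ↔ x ∈ N₂ := fun x => by
    rw [← hp0 x]; simp
  refine ⟨M₁.subtypeL.comp ((e.symm : M₂ →L[A] M₁).comp p), fun x => ?_, ?_, ?_⟩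
  · change ((e.symm (p (F (e.symm (p x) : M₁))) : M₁) : StdModule A) = (e.symm (p x) : M₁)
    rw [← he, hp, e.symm_apply_apply]
  · ext x
    refine Iff.trans ?_ (hk (F x)).symm
    refine ⟨h.mapsTo x, fun hx => ?_⟩
    have hx1 : x ∈ M₁ ⊔ N₁ := h.isCompl₁.sup_eq_top ▸ Submodule.mem_top
    obtain ⟨m, hm, n, hn, rfl⟩ := Submodule.mem_sup.1 hx1
    have h1 : F m ∈ N₂ := by
      rw [map_add] at hx
      exact (Submodule.add_mem_iff_left _ (h.mapsTo n hn)).1 hx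
    have h2 : F m ∈ M₂ := by
      rw [← he ⟨m, hm⟩]; exact Subtype.property _
    have h3 : F m = 0 := by
      have : F m ∈ M₂ ⊓ N₂ := ⟨h2, h1⟩
      rwa [h.isCompl₂.inf_eq_bot] at this
    have h4 : e ⟨m, hm⟩ = 0 := Subtype.ext ((he ⟨m, hm⟩).trans h3)
    have h5 : m = 0 := congrArg Subtype.val (e.map_eq_zero_iff.1 h4)
    rw [h5, zero_add]
    exact hn
  · ext x
    exact (hk x).symm

/-- The comparison map between the defects of two outer inverses of `F`. -/
theorem IsOuterInverse.exists_comparison (h : IsOuterInverse F G) (h' : IsOuterInverse F G') :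
    ∃ f : (kerOp (G * F) × kerOp G') →L[A] (kerOp G × kerOp (G' * F)),
      ∀ p, ((f p).1 : StdModule A) = F p.1 + (p.2 - F (G p.2)) ∧
        ((f p).2 : StdModule A) = (G p.2 - p.1) - G' (F (G p.2 - p.1)) := by
  let a : (kerOp (G * F) × kerOp G') →L[A] StdModule A :=
    (Submodule.subtypeL _).comp (ContinuousLinearMap.fst A _ _)
  let b : (kerOp (G * F) × kerOp G') →L[A] StdModule A :=
    (Submodule.subtypeL _).comp (ContinuousLinearMap.snd A _ _)
  refine ⟨((F.comp a + (b - F.comp (G.comp b))).codRestrict (kerOp G) fun p => ?_).prod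
    (((G.comp b - a) - G'.comp (F.comp (G.comp b - a))).codRestrict _ fun p => ?_),
    fun p => ⟨rfl, rfl⟩⟩
  · have h1 : G (F (a p)) = 0 := p.1.2
    change G (F (a p) + (b p - F (G (b p)))) = 0
    rw [map_add, map_sub, h, h1]; simp
  · change G' (F ((G (b p) - a p) - G' (F (G (b p) - a p)))) = 0
    rw [map_sub F, map_sub G', h', sub_self]

/-- Two outer inverses `G`, `G'` of `F` have isomorphic sums of defects:
`ker GF × ker G' ≃ ker G × ker G'F`. This is the splitting of the mapping cone of the homotopy
equivalence between the two-term complexes `F : ker GF → ker G` and `F : ker G'F → ker G'`. The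
comparison maps for `(G, G')` and for `(G', G)` are inverse to each other. -/
theorem IsOuterInverse.nonempty_prod_equiv (h : IsOuterInverse F G) (h' : IsOuterInverse F G') :
    Nonempty ((kerOp (G * F) × kerOp G') ≃L[A] (kerOp G × kerOp (G' * F))) := by
  have inv : ∀ {G G' : StdModule A →L[A] StdModule A}
      {f : (kerOp (G * F) × kerOp G') →L[A] (kerOp G × kerOp (G' * F))}
      {g : (kerOp (G' * F) × kerOp G) →L[A] (kerOp G' × kerOp (G * F))},
      IsOuterInverse F G →
      (∀ p, ((f p).1 : StdModule A) = F p.1 + (p.2 - F (G p.2)) ∧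
        ((f p).2 : StdModule A) = (G p.2 - p.1) - G' (F (G p.2 - p.1))) →
      (∀ p, ((g p).1 : StdModule A) = F p.1 + (p.2 - F (G' p.2)) ∧
        ((g p).2 : StdModule A) = (G' p.2 - p.1) - G (F (G' p.2 - p.1))) →
      ∀ p, (g (f p).swap).swap = p := by
    rintro G G' f g h hf hg ⟨x, y⟩
    have hx : G (F x) = 0 := x.2
    have hy : G' y = 0 := y.2
    have e1 := hf (x, y)
    have e2 := hg (f (x, y)).swap
    simp only [Prod.fst_swap, Prod.snd_swap] at e1 e2
    refine Prod.ext (Subtype.ext ?_) (Subtype.ext ?_)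
    · rw [Prod.fst_swap, e2.2, e1.1, e1.2]
      have h1 : G' (F x + (y - F (G y))) - (G y - x - G' (F (G y - x))) = x - G y := by
        simp only [map_add, map_sub, hy]; abel
      rw [h1, map_sub, map_sub, h, hx]
      abel
    · rw [Prod.snd_swap, e2.1, e1.1, e1.2]
      simp only [map_add, map_sub, hy, map_zero]
      abel
  obtain ⟨f, hf⟩ := h.exists_comparison h'
  obtain ⟨g, hg⟩ := h'.exists_comparison h
  let s : (kerOp (G * F) × kerOp G') →L[A] (kerOp (G' * F) × kerOp G) :=
    (ContinuousLinearEquiv.prodComm A (kerOp G) (kerOp (G' * F))).toContinuousLinearMap.comp f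
  let t : (kerOp (G' * F) × kerOp G) →L[A] (kerOp (G * F) × kerOp G') :=
    (ContinuousLinearEquiv.prodComm A (kerOp G') (kerOp (G * F))).toContinuousLinearMap.comp g
  exact ⟨(ContinuousLinearEquiv.equivOfInverse s t (inv h hf hg) (inv h' hg hf)).trans
    (ContinuousLinearEquiv.prodComm A _ _)⟩

/-- Operators that are inverse to each other on two kernels identify these kernels. -/
theorem nonempty_kerOp_equiv {a b u v : StdModule A →L[A] StdModule A}
    (hu : ∀ x, a x = 0 → b (u x) = 0) (hv : ∀ x, b x = 0 → a (v x) = 0)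
    (hvu : ∀ x, a x = 0 → v (u x) = x) (huv : ∀ x, b x = 0 → u (v x) = x) :
    Nonempty (kerOp a ≃L[A] kerOp b) :=
  ⟨ContinuousLinearEquiv.equivOfInverse
    ((u.comp (Submodule.subtypeL _)).codRestrict _ fun x => hu x x.2)
    ((v.comp (Submodule.subtypeL _)).codRestrict _ fun x => hv x x.2)
    (fun x => Subtype.ext (hvu x x.2)) (fun x => Subtype.ext (huv x x.2))⟩

/-- A decomposition of a kernel as the sum of another kernel and a copy of `P`, given by the
components of the two mutually inverse maps. -/
theorem nonempty_kerOp_equiv_prod {P : Type*} [NormedAddCommGroup P] [Module A P]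
    {a b u : StdModule A →L[A] StdModule A} {v : StdModule A →L[A] P} {w : P →L[A] StdModule A}
    (hu : ∀ x, a x = 0 → b (u x) = 0) (hw : ∀ y p, b y = 0 → a (y + w p) = 0)
    (hx : ∀ x, a x = 0 → u x + w (v x) = x) (hy : ∀ y p, b y = 0 → u (y + w p) = y)
    (hp : ∀ y p, b y = 0 → v (y + w p) = p) :
    Nonempty (kerOp a ≃L[A] kerOp b × P) :=
  ⟨ContinuousLinearEquiv.equivOfInverse
    (((u.comp (Submodule.subtypeL _)).codRestrict _ fun x => hu x x.2).prod
      (v.comp (Submodule.subtypeL _)))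
    (((Submodule.subtypeL _).comp (ContinuousLinearMap.fst A _ _) +
      w.comp (ContinuousLinearMap.snd A _ _)).codRestrict _ fun y => hw y.1 y.2 y.1.2)
    (fun x => Subtype.ext (hx x x.2))
    (by
      intro y
      exact Prod.ext (Subtype.ext (hy y.1 y.2 y.1.2)) (hp y.1 y.2 y.1.2))⟩

theorem isOuterInverse_iff : IsOuterInverse F G ↔ G * F * G = G :=
  ⟨fun h => ContinuousLinearMap.ext h, fun h x => congrArg (fun T : _ →L[A] _ => T x) h⟩

/-- Stability of decompositions: if `U = 1 + G(F' - F)` is invertible, then `U⁻¹G` is an outer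
inverse of `F'`; its defects are, up to isomorphism, those of `G`. -/
theorem IsOuterInverse.perturb (h : IsOuterInverse F G) (hU : IsUnit (1 + G * (F' - F))) :
    ∃ G', IsOuterInverse F' G' ∧ kerOp G' = kerOp G ∧
      Nonempty (kerOp (G' * F') ≃L[A] kerOp (G * F)) := by
  obtain ⟨U, hU⟩ := hU
  set W : StdModule A →L[A] StdModule A := ↑U⁻¹ with hW
  rw [isOuterInverse_iff] at h
  have hWU : W * U = 1 := U.inv_mul
  have hUW : U * W = 1 := U.mul_inv
  have hGF' : G * F' = U - (1 - G * F) := by rw [hU]; noncomm_ring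
  have hc : (1 - G * F) * W = 1 - G * F := by
    have h1 : (1 - G * F) * U = 1 - G * F := by
      rw [hU]
      calc (1 - G * F) * (1 + G * (F' - F)) = 1 - G * F + (G - G * F * G) * (F' - F) := by
            noncomm_ring
        _ = 1 - G * F := by rw [h, sub_self, zero_mul, add_zero]
    calc (1 - G * F) * W = (1 - G * F) * U * W := by rw [h1]
      _ = 1 - G * F := by rw [mul_assoc, hUW, mul_one]
  have hcG : (1 - G * F) * (W * G) = 0 := by
    rw [← mul_assoc, hc, sub_mul, one_mul, h, sub_self]
  have h2 : W * G * F' = 1 - W * (1 - G * F) := by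
    rw [mul_assoc, hGF', mul_sub, hWU]
  have h' : W * G * F' * (W * G) = W * G := by
    rw [h2, sub_mul, one_mul, mul_assoc, hcG, mul_zero, sub_zero]
  have h3 : W * G * F' * G = G := by
    rw [h2, sub_mul, one_mul, mul_assoc, sub_mul, one_mul, h, sub_self, mul_zero, sub_zero]
  have hker : ∀ x, W x = 0 ↔ x = 0 := fun x => by
    refine ⟨fun hx => ?_, fun hx => by rw [hx, map_zero]⟩
    have := congrArg (fun T : StdModule A →L[A] StdModule A => T x) hUW
    simp only [mul_apply_eq_comp, hx, map_zero, one_apply_eq_self] at this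
    exact this.symm
  have app : ∀ {S T : StdModule A →L[A] StdModule A}, S = T → ∀ x, S x = T x :=
    fun hST x => by rw [hST]
  refine ⟨W * G, isOuterInverse_iff.2 h', ?_, ?_⟩
  · ext x
    exact hker (G x)
  · refine nonempty_kerOp_equiv (u := 1 - G * F) (v := 1 - W * G * F') (fun x _ => ?_)
      (fun x _ => ?_) (fun x hx => ?_) (fun x hx => ?_)
    · refine app (S := G * F * (1 - G * F)) (T := 0) ?_ x
      rw [mul_sub, mul_one, ← mul_assoc, h, sub_self]
    · refine app (S := W * G * F' * (1 - W * G * F')) (T := 0) ?_ x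
      rw [mul_sub, mul_one, ← mul_assoc, h', sub_self]
    · have : (1 - W * G * F') * (1 - G * F) = 1 - W * G * F' := by
        rw [mul_sub, mul_one, ← mul_assoc, sub_mul, one_mul, h3, sub_self, zero_mul, sub_zero]
      refine (app this x).trans ?_
      rw [sub_apply, hx, sub_zero, one_apply_eq_self]
    · have : (1 - G * F) * (1 - W * G * F') = 1 - G * F := by
        rw [mul_sub, mul_one, ← mul_assoc, hcG, zero_mul, sub_zero]
      refine (app this x).trans ?_
      rw [sub_apply, hx, sub_zero, one_apply_eq_self]

/-- If the kernel of `GF` is finitely generated, then the range of `GF` contains a direct summand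
isomorphic to any given finitely generated Hilbert module `P`: since backward shifts tend to zero
on the kernel of `GF`, far out along the coordinates the range of `GF` is almost all of `H_A`. -/
theorem IsOuterInverse.exists_summand (h : IsOuterInverse F G) (hN : (kerOp (G * F)).FG)
    (P : Type*) [NormedAddCommGroup P] [NormedSpace ℂ P] [Module A P] [CStarModule A P]
    [CompleteSpace P] [Module.Finite A P] :
    ∃ (j : P →L[A] StdModule A) (q : StdModule A →L[A] P), (∀ p, q (j p) = p) ∧
      (∀ p, G (F (j p)) = j p) ∧ ∀ x, q (G (F x)) = q x := by
  obtain ⟨S, T, hTS⟩ := exists_section_retraction A P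
  have hb : ∃ C : ℝ, 0 < C ∧ ∀ x, ‖(1 - G * F) x‖ ≤ C * ‖x‖ :=
    ⟨_, by positivity, fun x => (((1 - G * F).restrictScalars ℂ).le_opNorm x).trans
      (mul_le_mul_of_nonneg_right (le_add_of_nonneg_right zero_le_one) (norm_nonneg x))⟩
  obtain ⟨C, hC, hb⟩ := hb
  obtain ⟨n, hn⟩ := exists_shiftLeft_le (isClosed_kerOp _) hN
    (show 0 < (2 * C)⁻¹ by positivity)
  have hU : IsUnit (1 + -(StdModule.shiftLeft n * (1 - G * F) * StdModule.shiftRight n)) := by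
    refine isUnit_one_add_of_bound _ (r := 1 / 2) (by norm_num) (by norm_num) fun x => ?_
    rw [neg_apply, norm_neg]
    change ‖StdModule.shiftLeft n ((1 - G * F) (StdModule.shiftRight n x))‖ ≤ _
    refine (hn _ ?_).trans ?_
    · change G (F (StdModule.shiftRight n x - G (F (StdModule.shiftRight n x)))) = 0
      rw [map_sub, map_sub, h, sub_self]
    · refine (mul_le_mul_of_nonneg_left (hb _) (by positivity)).trans (le_of_eq ?_)
      rw [StdModule.norm_shiftRight]
      field_simp
  obtain ⟨U, hU⟩ := hU
  have hUx : ∀ x, StdModule.shiftLeft n (G (F (StdModule.shiftRight n x))) =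
      (U : StdModule A →L[A] StdModule A) x := fun x => by
    rw [hU]
    simp
  refine ⟨G.comp (F.comp ((StdModule.shiftRight n).comp S)),
    T.comp ((↑U⁻¹ : StdModule A →L[A] StdModule A).comp
      ((StdModule.shiftLeft n).comp (G.comp F))), fun p => ?_, fun p => ?_, fun x => ?_⟩
  · simp only [ContinuousLinearMap.comp_apply]
    rw [h, hUx]
    have : (↑U⁻¹ : StdModule A →L[A] StdModule A) ((U : StdModule A →L[A] StdModule A) (S p)) =
        S p := congrArg (fun f : StdModule A →L[A] StdModule A => f (S p)) U.inv_mul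
    rw [this, hTS]
  · simp only [ContinuousLinearMap.comp_apply]
    rw [h]
  · simp only [ContinuousLinearMap.comp_apply]
    rw [h]

/-- A decomposition with finitely generated `N₁` can be changed so that a given finitely generated
Hilbert module `P` is added to both `N₁` and `N₂`: with `e = jq` the projection onto a copy of `P`
in `M₁`, the operator `(1 - e)G` is again an outer inverse. -/
theorem IsOuterInverse.stabilize (h : IsOuterInverse F G) (hN : (kerOp (G * F)).FG)
    (P : Type*) [NormedAddCommGroup P] [NormedSpace ℂ P] [Module A P] [CStarModule A P]
    [CompleteSpace P] [Module.Finite A P] :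
    ∃ G', IsOuterInverse F G' ∧ Nonempty (kerOp (G' * F) ≃L[A] kerOp (G * F) × P) ∧
      Nonempty (kerOp G' ≃L[A] kerOp G × P) := by
  obtain ⟨j, q, hqj, hj, hq⟩ := h.exists_summand hN P
  refine ⟨G - j.comp (q.comp G), fun x => ?_,
    nonempty_kerOp_equiv_prod (u := 1 - G * F) (v := q) (w := j) (fun x _ => ?_)
      (fun y p hy => ?_) (fun x hx => ?_) (fun y p hy => ?_) (fun y p hy => ?_),
    nonempty_kerOp_equiv_prod (u := 1 - F * G) (v := q.comp G) (w := F.comp j) (fun x _ => ?_)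
      (fun y p hy => ?_) (fun x hx => ?_) (fun y p hy => ?_) (fun y p hy => ?_)⟩
  · change G (F (G x - j (q (G x)))) - j (q (G (F (G x - j (q (G x)))))) = G x - j (q (G x))
    rw [hq, map_sub F, map_sub G, h, hj, map_sub q, hqj, sub_self, map_zero, sub_zero]
  · change G (F (x - G (F x))) = 0
    rw [map_sub, map_sub, h, sub_self]
  · change G (F y) = 0 at hy
    change G (F (y + j p)) - j (q (G (F (y + j p)))) = 0
    rw [map_add, map_add, hy, zero_add, hj, hqj, sub_self]
  · change G (F x) - j (q (G (F x))) = 0 at hx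
    change (x - G (F x)) + j (q x) = x
    rw [hq] at hx
    rw [sub_eq_zero.1 hx, sub_add_cancel]
  · change G (F y) = 0 at hy
    change (y + j p) - G (F (y + j p)) = y
    rw [map_add, map_add, hy, hj, zero_add, add_sub_cancel_right]
  · change G (F y) = 0 at hy
    rw [map_add, hqj, ← hq, hy, map_zero, zero_add]
  · change G (x - F (G x)) = 0
    rw [map_sub, h, sub_self]
  · change G (y + F (j p)) - j (q (G (y + F (j p)))) = 0
    rw [map_add, hy, zero_add, hj, hqj, sub_self]
  · change G x - j (q (G x)) = 0 at hx
    change (x - F (G x)) + F (j (q (G x))) = x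
    rw [← sub_eq_zero.1 hx, sub_add_cancel]
  · change (y + F (j p)) - F (G (y + F (j p))) = y
    rw [map_add, hy, hj, zero_add, add_sub_cancel_right]
  · change q (G (y + F (j p))) = p
    rw [map_add, hy, zero_add, hj, hqj]

end OuterInverses

/-! ### Retracts and cancellation -/

section Retracts

variable {A : Type u} [CStarAlgebra A] [PartialOrder A] [StarOrderedRing A]

variable (A) in
/-- `M` is a topological direct summand of `N`, up to isomorphism. -/
def IsRetract (M N : Type*) [TopologicalSpace M] [AddCommGroup M] [Module A M]
    [TopologicalSpace N] [AddCommGroup N] [Module A N] : Prop :=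
  ∃ (i : M →L[A] N) (r : N →L[A] M), ∀ x, r (i x) = x

theorem fg_of_equiv {M N : Submodule A (StdModule A)} (e : M ≃L[A] N) (hM : M.FG) : N.FG := by
  have : Module.Finite A M := Module.Finite.iff_fg.2 hM
  exact Module.Finite.iff_fg.1 (Module.Finite.equiv e.toLinearEquiv)

/-- A finitely generated module is subordinate to `N` exactly if it is a retract of `N`, because
finitely generated closed submodules are complemented. -/
theorem isSubordinate_iff_isRetract {M N : Submodule A (StdModule A)} (hM : M.FG)
    (hN : IsClosed (N : Set (StdModule A))) : IsSubordinate M N ↔ IsRetract A M N := by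
  constructor
  · rintro ⟨L, hLc, hLN, ⟨e⟩⟩
    obtain ⟨p, hp, hpL⟩ := exists_projection hLc (fg_of_equiv e hM)
    refine ⟨(L.subtypeL.comp (e : M →L[A] L)).codRestrict N fun x => hLN (e x).2,
      (e.symm : L →L[A] M).comp ((p.codRestrict L hp).comp N.subtypeL), fun x => ?_⟩
    have h : p.codRestrict L hp (e x : StdModule A) = e x := Subtype.ext (hpL _ (e x).2)
    exact (congrArg e.symm h).trans (e.symm_apply_apply x)
  · rintro ⟨i, r, hri⟩
    let K : Submodule A N := LinearMap.ker ((1 - i.comp r : N →L[A] N) : N →ₗ[A] N)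
    have hK : ∀ x : N, x ∈ K ↔ i (r x) = x := fun x => by
      change x - i (r x) = 0 ↔ _
      rw [sub_eq_zero, eq_comm]
    have hKc : IsClosed (K : Set N) := ContinuousLinearMap.isClosed_ker (1 - i.comp r)
    have hle : K.map N.subtype ≤ N := Submodule.map_subtype_le N K
    refine ⟨K.map N.subtype, hN.isClosedEmbedding_subtypeVal.isClosedMap _ hKc, hle,
      ⟨ContinuousLinearEquiv.equivOfInverse
        ((N.subtypeL.comp i).codRestrict _ fun x => ⟨i x, (hK _).2 (by rw [hri]), rfl⟩)
        (r.comp (((K.map N.subtype).subtypeL).codRestrict N fun x => hle x.2))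
        (fun x => hri x) ?_⟩⟩
    rintro ⟨x, y, hy, rfl⟩
    refine Subtype.ext ?_
    change ((i (r y) : N) : StdModule A) = y
    rw [(hK y).1 hy]

/-- A finitely generated closed submodule of `H_A`, as a Hilbert module. -/
noncomputable def toFGHilbertModule (N : Submodule A (StdModule A))
    (hc : IsClosed (N : Set (StdModule A))) (hf : N.FG) : FGHilbertModule A :=
  have : CompleteSpace N := hc.completeSpace_coe
  have : Module.Finite A N := Module.Finite.iff_fg.2 hf
  { carrier := N }

/-- The isomorphism class of a finitely generated Hilbert module. -/
def fgClass (M : FGHilbertModule A) : FGClass A := Quotient.mk _ M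

theorem fgClass_eq_iff {A : Type u} [CStarAlgebra A] [PartialOrder A] {M N : FGHilbertModule A} :
    fgClass M = fgClass N ↔ Nonempty (M.carrier ≃L[A] N.carrier) :=
  Quotient.eq

theorem fgClass_sum (M N : FGHilbertModule A) : fgClass (M.sum N) = fgClass M + fgClass N := rfl

theorem kClass_eq_of (N : Submodule A (StdModule A)) (hc : IsClosed (N : Set (StdModule A)))
    (hf : N.FG) : kClass N hc hf =
      Algebra.GrothendieckAddGroup.of (fgClass (toFGHilbertModule N hc hf)) := rfl

theorem kClass_add_eq_of_equiv {M N P Q : Submodule A (StdModule A)}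
    (hMc : IsClosed (M : Set (StdModule A))) (hM : M.FG)
    (hNc : IsClosed (N : Set (StdModule A))) (hN : N.FG)
    (hPc : IsClosed (P : Set (StdModule A))) (hP : P.FG)
    (hQc : IsClosed (Q : Set (StdModule A))) (hQ : Q.FG)
    (e : (M × N) ≃L[A] (P × Q)) :
    kClass M hMc hM + kClass N hNc hN = kClass P hPc hP + kClass Q hQc hQ := by
  rw [kClass_eq_of, kClass_eq_of, kClass_eq_of, kClass_eq_of, ← map_add, ← map_add,
    ← fgClass_sum, ← fgClass_sum]
  exact congrArg _ (fgClass_eq_iff.2 ⟨(FGHilbertModule.sumEquiv _ _).trans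
    (ContinuousLinearEquiv.trans e (FGHilbertModule.sumEquiv (toFGHilbertModule P hPc hP)
      (toFGHilbertModule Q hQc hQ)).symm)⟩)

theorem kClass_congr {M N : Submodule A (StdModule A)}
    (hMc : IsClosed (M : Set (StdModule A))) (hM : M.FG)
    (hNc : IsClosed (N : Set (StdModule A))) (hN : N.FG) (e : M ≃L[A] N) :
    kClass M hMc hM = kClass N hNc hN :=
  congrArg Algebra.GrothendieckAddGroup.of (fgClass_eq_iff.2 ⟨e⟩)

/-- Equality in `K(A)` is isomorphism after adding a finitely generated Hilbert module. -/
theorem exists_equiv_of_kClass_eq {M N : Submodule A (StdModule A)}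
    {hMc : IsClosed (M : Set (StdModule A))} {hM : M.FG}
    {hNc : IsClosed (N : Set (StdModule A))} {hN : N.FG}
    (h : kClass M hMc hM = kClass N hNc hN) :
    ∃ P : FGHilbertModule A, Nonempty ((M × P.carrier) ≃L[A] (N × P.carrier)) := by
  obtain ⟨⟨c, _⟩, hc⟩ :=
    (AddLocalization.addMonoidOf (⊤ : AddSubmonoid (FGClass A))).eq_iff_exists.1
      (show AddLocalization.addMonoidOf ⊤ (fgClass (toFGHilbertModule M hMc hM)) =
        AddLocalization.addMonoidOf ⊤ (fgClass (toFGHilbertModule N hNc hN)) from h)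
  obtain ⟨P, rfl⟩ : ∃ P, c = fgClass P := Quotient.exists_rep c |>.imp fun _ h => h.symm
  obtain ⟨e⟩ := fgClass_eq_iff.1 (hc : fgClass (P.sum _) = fgClass (P.sum _))
  exact ⟨P, ⟨(ContinuousLinearEquiv.prodComm A _ _).trans
    ((((FGHilbertModule.sumEquiv P (toFGHilbertModule M hMc hM)).symm.trans e).trans
      (FGHilbertModule.sumEquiv P (toFGHilbertModule N hNc hN))).trans
    (ContinuousLinearEquiv.prodComm A _ _))⟩⟩

/-- A retract of a finitely generated Hilbert module is isomorphic to a finitely generated closed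
submodule of `H_A`. -/
theorem IsRetract.exists_submodule {W : Type*} [TopologicalSpace W] [AddCommGroup W] [Module A W]
    {V : FGHilbertModule A} (h : IsRetract A W V.carrier) :
    ∃ Z : Submodule A (StdModule A), IsClosed (Z : Set (StdModule A)) ∧ Z.FG ∧
      Nonempty (Z ≃L[A] W) := by
  obtain ⟨i, r, hri⟩ := h
  obtain ⟨S, T, hTS⟩ := exists_section_retraction A V.carrier
  let i' : W →L[A] StdModule A := S.comp i
  let r' : StdModule A →L[A] W := r.comp T
  have hri' : ∀ w, r' (i' w) = w := fun w => by
    change r (T (S (i w))) = w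
    rw [hTS, hri]
  have hmem : ∀ x, x ∈ kerOp (1 - i'.comp r') ↔ i' (r' x) = x := fun x => by
    change x - i' (r' x) = 0 ↔ _
    rw [sub_eq_zero, eq_comm]
  have e : kerOp (1 - i'.comp r') ≃L[A] W := ContinuousLinearEquiv.equivOfInverse
    (r'.comp (Submodule.subtypeL _)) (i'.codRestrict _ fun w => (hmem _).2 (by rw [hri']))
    (fun x => Subtype.ext ((hmem _).1 x.2)) hri'
  have : Module.Finite A W := Module.Finite.of_surjective (r : V.carrier →ₗ[A] W)
    fun w => ⟨i w, hri w⟩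
  exact ⟨_, isClosed_kerOp _,
    Module.Finite.iff_fg.1 (Module.Finite.equiv e.symm.toLinearEquiv), ⟨e⟩⟩

/-- Cancellation: if `X ⊕ Q ≅ Y ⊕ P` with `P` a retract of `Q`, then `X` is a retract of `Y`,
provided that `K(A)` has the cancellation property. With `R` a complement of `P` in `Q`, the sum
`X ⊕ R` has the class of `Y`. -/
theorem HasCancellation.isRetract (hA : HasCancellation A) {X Y P Q : Submodule A (StdModule A)}
    (hX : IsClosed (X : Set (StdModule A))) (hXf : X.FG)
    (hY : IsClosed (Y : Set (StdModule A))) (hYf : Y.FG)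
    (hP : IsClosed (P : Set (StdModule A))) (hPf : P.FG)
    (hQ : IsClosed (Q : Set (StdModule A))) (hQf : Q.FG)
    (e : (X × Q) ≃L[A] (Y × P)) (h : IsRetract A P Q) : IsRetract A X Y := by
  obtain ⟨i, r, hri⟩ := h
  let R : Submodule A Q := LinearMap.ker (r : Q →ₗ[A] P)
  let d : Q ≃L[A] P × R := ContinuousLinearEquiv.equivOfRightInverse r i hri
  let V : FGHilbertModule A := (toFGHilbertModule X hX hXf).sum (toFGHilbertModule Q hQ hQf)
  let v : V.carrier ≃L[A] X × Q := FGHilbertModule.sumEquiv _ _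
  have hret : IsRetract A (X × R) V.carrier := by
    refine ⟨(v.symm : X × Q →L[A] V.carrier).comp
        ((ContinuousLinearMap.id A X).prodMap R.subtypeL),
      ((ContinuousLinearMap.id A X).prodMap
        ((ContinuousLinearMap.snd A P R).comp (d : Q →L[A] P × R))).comp
          (v : V.carrier →L[A] X × Q), fun x => ?_⟩
    have hx : r (x.2 : Q) = 0 := x.2.2
    have h1 : (d (x.2 : Q)).2 = x.2 := Subtype.ext <| by
      change (x.2 : Q) - i (r x.2) = x.2
      rw [hx, map_zero, sub_zero]
    change ((v (v.symm (x.1, (x.2 : Q)))).1, (d (v (v.symm (x.1, (x.2 : Q)))).2).2) = x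
    rw [v.apply_symm_apply, h1]
  obtain ⟨Z, hZ, hZf, ⟨z⟩⟩ := hret.exists_submodule
  have f : (Z × P) ≃L[A] (Y × P) :=
    ((z.prodCongr (.refl A P)).trans (ContinuousLinearEquiv.prodAssoc A X R P)).trans
      (((ContinuousLinearEquiv.refl A X).prodCongr
        ((ContinuousLinearEquiv.prodComm A R P).trans d.symm)).trans e)
  obtain ⟨w⟩ := hA Z Y hZ hZf hY hYf
    (add_right_cancel (kClass_add_eq_of_equiv hZ hZf hP hPf hY hYf hP hPf f))
  let c : (X × R) ≃L[A] Y := z.symm.trans w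
  exact ⟨(c : X × R →L[A] Y).comp (ContinuousLinearMap.inl A X R),
    (ContinuousLinearMap.fst A X R).comp (c.symm : Y →L[A] X × R), fun x => by simp⟩

end Retracts

/-! ### The classes of operators in terms of outer inverses -/

section Classes

variable {A : Type u} [CStarAlgebra A] [PartialOrder A] [StarOrderedRing A]
  {F G G' : StdModule A →L[A] StdModule A}

/-- Finite generation passes between the defects of two outer inverses. -/
theorem IsOuterInverse.fg_of_fg (h : IsOuterInverse F G) (h' : IsOuterInverse F G')
    (h₁ : (kerOp (G' * F)).FG) (h₂ : (kerOp G).FG) : (kerOp (G * F)).FG ∧ (kerOp G').FG := by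
  obtain ⟨e⟩ := h.nonempty_prod_equiv h'
  have : Module.Finite A (kerOp (G' * F)) := Module.Finite.iff_fg.2 h₁
  have : Module.Finite A (kerOp G) := Module.Finite.iff_fg.2 h₂
  have : Module.Finite A (kerOp (G * F) × kerOp G') := Module.Finite.equiv e.symm.toLinearEquiv
  exact ⟨Module.Finite.iff_fg.1 (Module.Finite.of_surjective
      (LinearMap.fst A (kerOp (G * F)) (kerOp G')) LinearMap.fst_surjective),
    Module.Finite.iff_fg.1 (Module.Finite.of_surjective
      (LinearMap.snd A (kerOp (G * F)) (kerOp G')) LinearMap.snd_surjective)⟩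

/-- The operators with an outer inverse `G` whose defects `(ker GF, ker G)` satisfy a given
condition. -/
def classOf (Q : Submodule A (StdModule A) → Submodule A (StdModule A) → Prop) :
    Set (StdModule A →L[A] StdModule A) :=
  {F | IsAdjointable F ∧ ∃ G, IsOuterInverse F G ∧ Q (kerOp (G * F)) (kerOp G)}

theorem MPhiPlus_eq : MPhiPlus A = classOf fun N₁ _ => N₁.FG := by
  ext F
  refine and_congr_right fun _ => ⟨?_, fun ⟨G, hG, h⟩ => ⟨_, _, _, _, hG.isDecomposition, h⟩⟩
  rintro ⟨M₁, N₁, M₂, N₂, hd, h⟩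
  obtain ⟨G, hG, rfl, rfl⟩ := hd.exists_isOuterInverse
  exact ⟨G, hG, h⟩

theorem MPhiMinus_eq : MPhiMinus A = classOf fun _ N₂ => N₂.FG := by
  ext F
  refine and_congr_right fun _ => ⟨?_, fun ⟨G, hG, h⟩ => ⟨_, _, _, _, hG.isDecomposition, h⟩⟩
  rintro ⟨M₁, N₁, M₂, N₂, hd, h⟩
  obtain ⟨G, hG, rfl, rfl⟩ := hd.exists_isOuterInverse
  exact ⟨G, hG, h⟩

theorem MPhi_eq : MPhi A = classOf fun N₁ N₂ => N₁.FG ∧ N₂.FG := by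
  ext F
  refine and_congr_right fun _ => ⟨?_, fun ⟨G, hG, h⟩ => ⟨_, _, _, _, hG.isDecomposition, h⟩⟩
  rintro ⟨M₁, N₁, M₂, N₂, hd, h⟩
  obtain ⟨G, hG, rfl, rfl⟩ := hd.exists_isOuterInverse
  exact ⟨G, hG, h⟩

theorem MPhiTildePlusMinus_eq :
    MPhiTildePlusMinus A = classOf fun N₁ N₂ => N₁.FG ∧ N₂.FG ∧ IsRetract A N₁ N₂ := by
  ext F
  constructor
  · rintro ⟨hF, M₁, N₁, M₂, N₂, hd, h₁, h₂, h⟩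
    obtain ⟨G, hG, rfl, rfl⟩ := hd.exists_isOuterInverse
    exact ⟨hF.1, G, hG, h₁, h₂, (isSubordinate_iff_isRetract h₁ (isClosed_kerOp _)).1 h⟩
  · rintro ⟨hF, G, hG, h₁, h₂, h⟩
    exact ⟨⟨hF, _, _, _, _, hG.isDecomposition, h₁, h₂⟩, _, _, _, _, hG.isDecomposition, h₁, h₂,
      (isSubordinate_iff_isRetract h₁ (isClosed_kerOp _)).2 h⟩

theorem MPhiTildeMinusPlus_eq :
    MPhiTildeMinusPlus A = classOf fun N₁ N₂ => N₁.FG ∧ N₂.FG ∧ IsRetract A N₂ N₁ := by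
  ext F
  constructor
  · rintro ⟨hF, M₁, N₁, M₂, N₂, hd, h₁, h₂, h⟩
    obtain ⟨G, hG, rfl, rfl⟩ := hd.exists_isOuterInverse
    exact ⟨hF.1, G, hG, h₁, h₂, (isSubordinate_iff_isRetract h₂ (isClosed_kerOp _)).1 h⟩
  · rintro ⟨hF, G, hG, h₁, h₂, h⟩
    exact ⟨⟨hF, _, _, _, _, hG.isDecomposition, h₁, h₂⟩, _, _, _, _, hG.isDecomposition, h₁, h₂,
      (isSubordinate_iff_isRetract h₂ (isClosed_kerOp _)).2 h⟩

/-- The index does not depend on the decomposition. -/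
theorem HasIndex.unique {k l : KGroup A} (hk : HasIndex F k) (hl : HasIndex F l) : k = l := by
  obtain ⟨_, _, _, _, hd, h₁, h₂, rfl⟩ := hk
  obtain ⟨_, _, _, _, hd', h₁', h₂', rfl⟩ := hl
  obtain ⟨G, hG, rfl, rfl⟩ := hd.exists_isOuterInverse
  obtain ⟨G', hG', rfl, rfl⟩ := hd'.exists_isOuterInverse
  obtain ⟨e⟩ := hG.nonempty_prod_equiv hG'
  rw [sub_eq_sub_iff_add_eq_add, add_comm (kClass (kerOp (G' * F)) _ _)]
  exact kClass_add_eq_of_equiv _ _ _ _ _ _ _ _ e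

/-- Equality of the classes in `K(A)` of two finitely generated closed submodules. -/
def SameClass (N₁ N₂ : Submodule A (StdModule A)) : Prop :=
  ∃ hc₁ h₁ hc₂ h₂, kClass N₁ hc₁ h₁ = kClass N₂ hc₂ h₂

theorem MPhiZero_eq : MPhiZero A = classOf SameClass := by
  ext F
  constructor
  · rintro ⟨hF, h0⟩
    obtain ⟨M₁, N₁, M₂, N₂, hd, h₁, h₂, h⟩ : HasIndex F (index F hF) :=
      (exists_hasIndex hF).choose_spec
    rw [h0] at h
    obtain ⟨G, hG, rfl, rfl⟩ := hd.exists_isOuterInverse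
    exact ⟨hF.1, G, hG, _, _, _, _, sub_eq_zero.1 h.symm⟩
  · rintro ⟨hF, G, hG, hc₁, h₁, hc₂, h₂, h⟩
    have hF' : F ∈ MPhi A := ⟨hF, _, _, _, _, hG.isDecomposition, h₁, h₂⟩
    have h0 : HasIndex F 0 := ⟨_, _, _, _, hG.isDecomposition, h₁, h₂, (sub_eq_zero.2 h).symm⟩
    exact ⟨hF', (exists_hasIndex hF').choose_spec.unique h0⟩

/-- An operator of index zero has a decomposition with `N₁ ≅ N₂`. -/
theorem exists_equiv_of_mem_MPhiZero (hF : F ∈ MPhiZero A) :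
    ∃ G, IsOuterInverse F G ∧ (kerOp (G * F)).FG ∧ (kerOp G).FG ∧
      Nonempty (kerOp (G * F) ≃L[A] kerOp G) := by
  rw [MPhiZero_eq] at hF
  obtain ⟨-, G, hG, _, h₁, _, h₂, h⟩ := hF
  obtain ⟨P, ⟨e⟩⟩ := exists_equiv_of_kClass_eq h
  obtain ⟨G', hG', ⟨e₁⟩, ⟨e₂⟩⟩ := hG.stabilize h₁ P.carrier
  have : Module.Finite A (kerOp (G * F)) := Module.Finite.iff_fg.2 h₁
  have : Module.Finite A (kerOp G) := Module.Finite.iff_fg.2 h₂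
  exact ⟨G', hG', Module.Finite.iff_fg.1 (Module.Finite.equiv e₁.symm.toLinearEquiv),
    Module.Finite.iff_fg.1 (Module.Finite.equiv e₂.symm.toLinearEquiv),
    ⟨(e₁.trans e).trans e₂.symm⟩⟩

theorem isRetract_of_equiv {M N : Submodule A (StdModule A)} (e : M ≃L[A] N) : IsRetract A M N :=
  ⟨e, e.symm, e.symm_apply_apply⟩

theorem IsRetract.trans {M N P : Submodule A (StdModule A)} (h : IsRetract A M N)
    (h' : IsRetract A N P) : IsRetract A M P := by
  obtain ⟨i, r, hri⟩ := h
  obtain ⟨i', r', hri'⟩ := h'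
  exact ⟨i'.comp i, r.comp r', fun x => by simp [hri, hri']⟩

theorem MPhiZero_subset_plusMinus : MPhiZero A ⊆ MPhiTildePlusMinus A := fun F hF => by
  obtain ⟨G, hG, h₁, h₂, ⟨e⟩⟩ := exists_equiv_of_mem_MPhiZero hF
  rw [MPhiTildePlusMinus_eq]
  exact ⟨hF.1.1, G, hG, h₁, h₂, isRetract_of_equiv e⟩

theorem MPhiZero_subset_minusPlus : MPhiZero A ⊆ MPhiTildeMinusPlus A := fun F hF => by
  obtain ⟨G, hG, h₁, h₂, ⟨e⟩⟩ := exists_equiv_of_mem_MPhiZero hF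
  rw [MPhiTildeMinusPlus_eq]
  exact ⟨hF.1.1, G, hG, h₁, h₂, isRetract_of_equiv e.symm⟩

end Classes

/-! ### Translates by the center -/

section Translates

variable {A : Type u} [CStarAlgebra A] [PartialOrder A] [StarOrderedRing A]
  {F : StdModule A →L[A] StdModule A}

theorem IsAdjointable.sub_scalarOp (hF : IsAdjointable F) (α : Subalgebra.center ℂ A) :
    IsAdjointable (F - scalarOp α) := by
  obtain ⟨G, hG⟩ := hF
  have hα : ∀ b : A, star (α : A) * b = b * star (α : A) := fun b => by
    have h := congrArg star (Subalgebra.mem_center_iff.1 α.2 (star b))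
    simpa using h
  let β : Subalgebra.center ℂ A :=
    ⟨star (α : A), Subalgebra.mem_center_iff.2 fun b => (hα b).symm⟩
  refine ⟨G - scalarOp β, fun x y => ?_⟩
  change inner A (F x - (α : A) • x) y = inner A x (G y - star (α : A) • y)
  rw [CStarModule.inner_sub_left, CStarModule.inner_sub_right, hG,
    CStarModule.inner_op_smul_left, CStarModule.inner_op_smul_right, hα]

/-- Decompositions of `F - αI` are stable under small changes of `α`, with the same `N₂` and, up to
isomorphism, the same `N₁`. -/
theorem IsOuterInverse.eventually {α : Subalgebra.center ℂ A} {G : StdModule A →L[A] StdModule A}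
    (h : IsOuterInverse (F - scalarOp α) G) :
    ∀ᶠ β in 𝓝 α, ∃ G', IsOuterInverse (F - scalarOp β) G' ∧ kerOp G' = kerOp G ∧
      Nonempty (kerOp (G' * (F - scalarOp β)) ≃L[A] kerOp (G * (F - scalarOp α))) := by
  set C : ℝ := ‖(G.restrictScalars ℂ : StdModule A →L[ℂ] StdModule A)‖
  have hC : ∀ x, ‖G x‖ ≤ C * ‖x‖ := fun x =>
    (G.restrictScalars ℂ : StdModule A →L[ℂ] StdModule A).le_opNorm x
  have ht : Filter.Tendsto (fun β : Subalgebra.center ℂ A => C * ‖(α : A) - β‖) (𝓝 α) (𝓝 0) := by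
    have : Continuous fun β : Subalgebra.center ℂ A => C * ‖(α : A) - β‖ := by fun_prop
    simpa using this.tendsto α
  filter_upwards [ht.eventually_lt_const (zero_lt_one (α := ℝ))] with β hβ
  refine h.perturb (isUnit_one_add_of_bound _ (by positivity) hβ fun x => ?_)
  have hx : (G * (F - scalarOp β - (F - scalarOp α))) x = G (((α : A) - β) • x) := by
    change G ((F x - (β : A) • x) - (F x - (α : A) • x)) = _
    rw [sub_smul]
    congr 1
    abel
  rw [hx, mul_assoc]
  exact (hC _).trans (by gcongr; exact norm_smul_le_mul_norm _ _)

/-- A class of operators given by a condition on the defects that depends on `N₁` only up to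
isomorphism is stable under small translations. -/
theorem isOpen_setOf_mem_classOf (hF : IsAdjointable F)
    {Q : Submodule A (StdModule A) → Submodule A (StdModule A) → Prop}
    (hQ : ∀ N₁ N₁' N₂ : Submodule A (StdModule A), IsClosed (N₁' : Set (StdModule A)) →
      (N₁' ≃L[A] N₁) → Q N₁ N₂ → Q N₁' N₂) :
    IsOpen {α | F - scalarOp α ∈ classOf Q} := by
  refine isOpen_iff_eventually.2 fun α hα => ?_
  obtain ⟨-, G, hG, h⟩ := hα
  filter_upwards [hG.eventually] with β hβ
  obtain ⟨G', hG', hk, ⟨e⟩⟩ := hβ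
  exact ⟨hF.sub_scalarOp β, G', hG', hk ▸ hQ _ _ _ (isClosed_kerOp _) e h⟩

theorem isOpen_setOf_mem_MPhi (hF : IsAdjointable F) : IsOpen {α | F - scalarOp α ∈ MPhi A} := by
  rw [MPhi_eq]
  exact isOpen_setOf_mem_classOf hF fun _ _ _ _ e h => ⟨fg_of_equiv e.symm h.1, h.2⟩

theorem isOpen_setOf_mem_MPhiPlus (hF : IsAdjointable F) :
    IsOpen {α | F - scalarOp α ∈ MPhiPlus A} := by
  rw [MPhiPlus_eq]
  exact isOpen_setOf_mem_classOf hF fun _ _ _ _ e h => fg_of_equiv e.symm h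

theorem isOpen_setOf_mem_MPhiMinus (hF : IsAdjointable F) :
    IsOpen {α | F - scalarOp α ∈ MPhiMinus A} := by
  rw [MPhiMinus_eq]
  exact isOpen_setOf_mem_classOf hF fun _ _ _ _ _ h => h

theorem isOpen_setOf_mem_MPhiTildePlusMinus (hF : IsAdjointable F) :
    IsOpen {α | F - scalarOp α ∈ MPhiTildePlusMinus A} := by
  rw [MPhiTildePlusMinus_eq]
  exact isOpen_setOf_mem_classOf hF fun _ _ _ _ e h =>
    ⟨fg_of_equiv e.symm h.1, h.2.1, (isRetract_of_equiv e).trans h.2.2⟩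

theorem isOpen_setOf_mem_MPhiTildeMinusPlus (hF : IsAdjointable F) :
    IsOpen {α | F - scalarOp α ∈ MPhiTildeMinusPlus A} := by
  rw [MPhiTildeMinusPlus_eq]
  exact isOpen_setOf_mem_classOf hF fun _ _ _ _ e h =>
    ⟨fg_of_equiv e.symm h.1, h.2.1, h.2.2.trans (isRetract_of_equiv e.symm)⟩

theorem isOpen_setOf_mem_MPhiZero (hF : IsAdjointable F) :
    IsOpen {α | F - scalarOp α ∈ MPhiZero A} := by
  rw [MPhiZero_eq]
  refine isOpen_setOf_mem_classOf hF fun _ _ _ hc e h => ?_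
  obtain ⟨hc₁, h₁, hc₂, h₂, h⟩ := h
  exact ⟨hc, fg_of_equiv e.symm h₁, hc₂, h₂, (kClass_congr _ _ _ _ e).trans h⟩

variable {α : Subalgebra.center ℂ A}

/-- If `F - αI` is upper semi-Fredholm and a limit of Fredholm operators `F - βI`, it is
Fredholm. -/
theorem mem_MPhi_of_mem_MPhiPlus (h : F - scalarOp α ∈ MPhiPlus A)
    (hf : ∃ᶠ β in 𝓝 α, F - scalarOp β ∈ MPhi A) : F - scalarOp α ∈ MPhi A := by
  rw [MPhiPlus_eq] at h
  rw [MPhi_eq] at hf ⊢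
  obtain ⟨ha, G, hG, h₁⟩ := h
  obtain ⟨β, ⟨-, G', hG', h₁', h₂'⟩, G'', hG'', hk, ⟨e⟩⟩ := (hf.and_eventually hG.eventually).exists
  exact ⟨ha, G, hG, h₁, hk ▸ (hG'.fg_of_fg hG'' (fg_of_equiv e.symm h₁) h₂').2⟩

/-- If `F - αI` is lower semi-Fredholm and a limit of Fredholm operators `F - βI`, it is
Fredholm. -/
theorem mem_MPhi_of_mem_MPhiMinus (h : F - scalarOp α ∈ MPhiMinus A)
    (hf : ∃ᶠ β in 𝓝 α, F - scalarOp β ∈ MPhi A) : F - scalarOp α ∈ MPhi A := by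
  rw [MPhiMinus_eq] at h
  rw [MPhi_eq] at hf ⊢
  obtain ⟨ha, G, hG, h₂⟩ := h
  obtain ⟨β, ⟨-, G', hG', h₁', h₂'⟩, G'', hG'', hk, ⟨e⟩⟩ := (hf.and_eventually hG.eventually).exists
  exact ⟨ha, G, hG, fg_of_equiv e (hG''.fg_of_fg hG' h₁' (hk.symm ▸ h₂)).1, h₂⟩

/-- A Fredholm operator that is a limit of translates of index zero has index zero, because the
index is locally constant. -/
theorem mem_MPhiZero_of_mem_MPhi (h : F - scalarOp α ∈ MPhi A)
    (hf : ∃ᶠ β in 𝓝 α, F - scalarOp β ∈ MPhiZero A) : F - scalarOp α ∈ MPhiZero A := by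
  rw [MPhi_eq] at h
  rw [MPhiZero_eq] at hf ⊢
  obtain ⟨ha, G, hG, h₁, h₂⟩ := h
  obtain ⟨β, ⟨-, G', hG', hc₁', h₁', hc₂', h₂', h⟩, G'', hG'', hk, ⟨e⟩⟩ :=
    (hf.and_eventually hG.eventually).exists
  obtain ⟨f⟩ := hG'.nonempty_prod_equiv hG''
  rw [hk] at f
  have h3 := kClass_add_eq_of_equiv hc₁' h₁' (isClosed_kerOp _) h₂ hc₂' h₂' (isClosed_kerOp _)
    (fg_of_equiv e.symm h₁) f
  rw [h, add_right_inj, kClass_congr _ _ (isClosed_kerOp _) h₁ e] at h3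
  exact ⟨ha, G, hG, _, _, _, _, h3.symm⟩

/-- Under the cancellation property, `ℳ̃Φ₊⁻` is closed within the Fredholm translates: the
comparison of defects carries `N₁ ⪯ N₂` from the decompositions of nearby translates to a given
decomposition of `F - αI`. -/
theorem mem_MPhiTildePlusMinus_of_mem_MPhi (hA : HasCancellation A)
    (h : F - scalarOp α ∈ MPhi A)
    (hf : ∃ᶠ β in 𝓝 α, F - scalarOp β ∈ MPhiTildePlusMinus A) :
    F - scalarOp α ∈ MPhiTildePlusMinus A := by
  rw [MPhi_eq] at h
  rw [MPhiTildePlusMinus_eq] at hf ⊢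
  obtain ⟨ha, G, hG, h₁, h₂⟩ := h
  obtain ⟨β, ⟨-, G', hG', h₁', h₂', h⟩, G'', hG'', hk, ⟨e⟩⟩ :=
    (hf.and_eventually hG.eventually).exists
  obtain ⟨f⟩ := hG''.nonempty_prod_equiv hG'
  rw [hk] at f
  exact ⟨ha, G, hG, h₁, h₂, (isRetract_of_equiv e.symm).trans
    (hA.isRetract (isClosed_kerOp _) (fg_of_equiv e.symm h₁) (isClosed_kerOp _) h₂
      (isClosed_kerOp _) h₁' (isClosed_kerOp _) h₂' f h)⟩

/-- Under the cancellation property, `ℳ̃Φ₋⁺` is closed within the Fredholm translates. -/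
theorem mem_MPhiTildeMinusPlus_of_mem_MPhi (hA : HasCancellation A)
    (h : F - scalarOp α ∈ MPhi A)
    (hf : ∃ᶠ β in 𝓝 α, F - scalarOp β ∈ MPhiTildeMinusPlus A) :
    F - scalarOp α ∈ MPhiTildeMinusPlus A := by
  rw [MPhi_eq] at h
  rw [MPhiTildeMinusPlus_eq] at hf ⊢
  obtain ⟨ha, G, hG, h₁, h₂⟩ := h
  obtain ⟨β, ⟨-, G', hG', h₁', h₂', h⟩, G'', hG'', hk, ⟨e⟩⟩ :=
    (hf.and_eventually hG.eventually).exists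
  obtain ⟨f⟩ := hG'.nonempty_prod_equiv hG''
  rw [hk] at f
  exact ⟨ha, G, hG, h₁, h₂, (hA.isRetract (isClosed_kerOp _) h₂ (isClosed_kerOp _)
    (fg_of_equiv e.symm h₁) (isClosed_kerOp _) h₂' (isClosed_kerOp _) h₁'
    (((ContinuousLinearEquiv.prodComm A _ _).trans f).trans (ContinuousLinearEquiv.prodComm A _ _))
    h).trans (isRetract_of_equiv e)⟩

end Translates

/-! ### Boundaries of the spectra -/

section Boundaries

/-- If an open set `U` is relatively closed in a larger set `V`, then the boundary of the
complement of `U` is contained in the boundary of the complement of `V`. -/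
theorem frontier_compl_subset {X : Type*} [TopologicalSpace X] {U V : Set X} (hU : IsOpen U)
    (hUV : U ⊆ V) (h : ∀ x ∈ V, (∃ᶠ y in 𝓝 x, y ∈ U) → x ∈ U) :
    frontier Uᶜ ⊆ frontier Vᶜ := by
  rw [frontier_compl, frontier_compl]
  rintro x ⟨hx, hxU⟩
  rw [hU.interior_eq] at hxU
  exact ⟨closure_mono hUV hx, fun hV =>
    hxU (h x (interior_subset hV) (mem_closure_iff_frequently.1 hx))⟩

variable {A : Type u} [CStarAlgebra A] [PartialOrder A] [StarOrderedRing A]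
  {F : StdModule A →L[A] StdModule A}

theorem isOpen_setOf_mem_MPhiPlusMinus (hF : IsAdjointable F) :
    IsOpen {α | F - scalarOp α ∈ MPhiPlusMinus A} := by
  refine isOpen_iff_eventually.2 fun α hα => ?_
  rcases hα with hα | ⟨hα, hn⟩
  · exact ((isOpen_setOf_mem_MPhiTildePlusMinus hF).eventually_mem hα).mono fun β hβ => Or.inl hβ
  · have h := Filter.not_frequently.1 (mt (mem_MPhi_of_mem_MPhiPlus hα) hn)
    filter_upwards [h, (isOpen_setOf_mem_MPhiPlus hF).eventually_mem hα] with β h1 h2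
    exact Or.inr ⟨h2, h1⟩

theorem isOpen_setOf_mem_MPhiMinusPlus (hF : IsAdjointable F) :
    IsOpen {α | F - scalarOp α ∈ MPhiMinusPlus A} := by
  refine isOpen_iff_eventually.2 fun α hα => ?_
  rcases hα with hα | ⟨hα, hn⟩
  · exact ((isOpen_setOf_mem_MPhiTildeMinusPlus hF).eventually_mem hα).mono fun β hβ => Or.inl hβ
  · have h := Filter.not_frequently.1 (mt (mem_MPhi_of_mem_MPhiMinus hα) hn)
    filter_upwards [h, (isOpen_setOf_mem_MPhiMinus hF).eventually_mem hα] with β h1 h2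
    exact Or.inr ⟨h2, h1⟩

theorem MPhi_subset_MPhiPlus : MPhi A ⊆ MPhiPlus A := fun _ ⟨ha, _, _, _, _, hd, h₁, _⟩ =>
  ⟨ha, _, _, _, _, hd, h₁⟩

theorem MPhi_subset_MPhiMinus : MPhi A ⊆ MPhiMinus A := fun _ ⟨ha, _, _, _, _, hd, _, h₂⟩ =>
  ⟨ha, _, _, _, _, hd, h₂⟩

end Boundaries

end HilbertFredholm

open HilbertFredholm in
theorem theorem4p3 {A : Type*} [CStarAlgebra A] [PartialOrder A] [StarOrderedRing A]
    (F : HilbertFredholm.StdModule A →L[A] HilbertFredholm.StdModule A)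
    (hF : HilbertFredholm.IsAdjointable F) :
    frontier (HilbertFredholm.sigmaEW F) ⊆ frontier (HilbertFredholm.sigmaEATilde F) ∧
    frontier (HilbertFredholm.sigmaEATilde F) ⊆ frontier (HilbertFredholm.sigmaEA F) ∧
    (HilbertFredholm.HasCancellation A →
      frontier (HilbertFredholm.sigmaEA F) ⊆ frontier (HilbertFredholm.sigmaEAlpha F)) ∧
    frontier (HilbertFredholm.sigmaEW F) ⊆ frontier (HilbertFredholm.sigmaEBTilde F) ∧
    frontier (HilbertFredholm.sigmaEBTilde F) ⊆ frontier (HilbertFredholm.sigmaEB F) ∧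
    (HilbertFredholm.HasCancellation A →
      frontier (HilbertFredholm.sigmaEB F) ⊆ frontier (HilbertFredholm.sigmaEBeta F)) := by
  refine ⟨?_, ?_, fun hA => ?_, ?_, ?_, fun hA => ?_⟩
  · exact frontier_compl_subset (isOpen_setOf_mem_MPhiZero hF)
      (fun α h => MPhiZero_subset_plusMinus h) fun α h hf => mem_MPhiZero_of_mem_MPhi h.1 hf
  · refine frontier_compl_subset (isOpen_setOf_mem_MPhiTildePlusMinus hF) (fun α h => Or.inl h) ?_
    rintro α (h | ⟨h, hn⟩) hf
    · exact h
    · exact absurd (mem_MPhi_of_mem_MPhiPlus h (hf.mono fun β hβ => hβ.1)) hn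
  · refine frontier_compl_subset (isOpen_setOf_mem_MPhiPlusMinus hF)
      (fun α h => h.elim (fun h => MPhi_subset_MPhiPlus h.1) fun h => h.1) fun α h hf => ?_
    by_cases hn : F - scalarOp α ∈ MPhi A
    -- Near `α` all translates are Fredholm, so those in `ℳΦ₊⁻` belong to `ℳ̃Φ₊⁻`.
    · refine Or.inl (mem_MPhiTildePlusMinus_of_mem_MPhi hA hn ?_)
      exact (hf.and_eventually ((isOpen_setOf_mem_MPhi hF).eventually_mem hn)).mono
        fun β hβ => hβ.1.resolve_right fun h' => h'.2 hβ.2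
    · exact Or.inr ⟨h, hn⟩
  · exact frontier_compl_subset (isOpen_setOf_mem_MPhiZero hF)
      (fun α h => MPhiZero_subset_minusPlus h) fun α h hf => mem_MPhiZero_of_mem_MPhi h.1 hf
  · refine frontier_compl_subset (isOpen_setOf_mem_MPhiTildeMinusPlus hF) (fun α h => Or.inl h) ?_
    rintro α (h | ⟨h, hn⟩) hf
    · exact h
    · exact absurd (mem_MPhi_of_mem_MPhiMinus h (hf.mono fun β hβ => hβ.1)) hn
  · refine frontier_compl_subset (isOpen_setOf_mem_MPhiMinusPlus hF)
      (fun α h => h.elim (fun h => MPhi_subset_MPhiMinus h.1) fun h => h.1) fun α h hf => ?_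
    by_cases hn : F - scalarOp α ∈ MPhi A
    · refine Or.inl (mem_MPhiTildeMinusPlus_of_mem_MPhi hA hn ?_)
      exact (hf.and_eventually ((isOpen_setOf_mem_MPhi hF).eventually_mem hn)).mono
        fun β hβ => hβ.1.resolve_right fun h' => h'.2 hβ.2
    · exact Or.inr ⟨h, hn⟩
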